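/- **Conventions.** All vector spaces are over $\mathbb C$. A complex is a graded space $X^{[*]}=\bigoplus_{p\in\mathbb Z}X^{[p]}$ with a differential $d$ of degree $1$, $d^2=0$; $|x|$ is the degree of a homogeneous $x$. Chain maps have degree $0$ and commute with $d$. A *dg vertex algebra* is a complex $V=V^{[*]}$ with $\mathbf 1\in V^{[0]}$, $d\mathbf 1=0$, and bilinear products $(u,v)\mapsto u_nv$ ($n\in\mathbb Z$), $Y(u,x)=\sum_n u_nx^{-n-1}$, such that $|u_nv|=|u|+|v|-2n-2$, $d(u_nv)=(du)_nv+(-1)^{|u|}u_n(dv)$, $u_nv=0$ for $n\gg0$, $\mathbf 1_n=\delta_{n,-1}\mathrm{id}$, $v_n\mathbf 1=0$ for $n\ge0$, $v_{-1}\mathbf 1=v$, and the Jacobi identity holds: for homogeneous $u,v$ and all $l,m,n\in\mathbb Z$, $$\sum_{i\ge0}(-1)^i\binom li\bigl(u_{m+l-i}v_{n+i}-(-1)^{l+|u||v|}v_{n+l-i}u_{m+i}\bigr)=\sum_{i\ge0}\binom mi(u_{l+i}v)_{m+n-i}.$$ It is a *dg vertex operator algebra* if moreover there is given $\omega\in V^{[4]}$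 with $d\omega=0$ such that the $L(n)=\omega_{n+1}$ satisfy the Virasoro relations for some central charge, $L(-1)v=v_{-2}\mathbf 1$, $V=\bigoplus_{n\in\frac12\mathbb Z}V_n$ with $V_n=\ker(L(0)-n)$ finite-dimensional and zero for $n\ll0$, and $\omega\in V_2$. For $u\in V_n$ write $\mathrm{wt}(u)=n$. A *weak dg $V$-module* is a complex $M$ with products $u_nm\in M$ ($u\in V$, $m\in M$, $n\in\mathbb Z$) satisfying the same degree, differential, truncation, vacuum and Jacobi axioms (there $(u_{l+i}v)_{m+n-i}$ is formed with the products of $V$). Morphisms are chain maps $f$ with $f(u_nm)=u_nf(m)$; they form the category $V\text{-Mod}^w$. For $u\in V$ of weight $\mathrm{wt}(u)$ and $m\in M$ put $$u\circ m=\sum_{n\ge0}\binom{\mathrm{wt}(u)}nu_{n-2}m,\qquad u*_lm=\sum_{n\ge0}\binom{\mathrm{wt}(u)}nu_{n-1}m,$$ and, if $u,m$ are also homogeneous for the degree, $m*_ru=(-1)^{|u||m|}\sum_{n\ge0}\binom{\mathrm{wt}(u)-1}nu_{n-1}m$; extend $*_l,*_r$ bilinearly. Let $O(M)=\mathrm{span}\{u\circ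 m\}$, $A(M)=M/O(M)$, let $[m]$ be the class of $m$, let $F^pA(M)$ be the image of $\bigoplus_{q\le p}M^{[q]}$, and let $\mathrm{gr}^{[*]}A(M)=\bigoplus_pF^pA(M)/F^{p-1}A(M)$, with the differential induced by $d_M$ (which preserves $O(M)$). For $w\in F^pA(M)$ let $\widetilde w$ be its class in $F^pA(M)/F^{p-1}A(M)$. The case $M=V$ gives $A(V)$, with product $*=*_l$. A *dg Poisson algebra* with bracket of degree $r$ is a unital associative graded commutative dg algebra $R$ with a bracket $\{,\}$ of degree $r$ such that for homogeneous elements $\{x,y\}=-(-1)^{(|x|+r)(|y|+r)}\{y,x\}$, $\{x,\{y,z\}\}=\{\{x,y\},z\}+(-1)^{(|x|+r)(|y|+r)}\{y,\{x,z\}\}$, $\{x,yz\}=\{x,y\}z+(-1)^{(|x|+r)|y|}y\{x,z\}$ and $d\{x,y\}=(-1)^r\{dx,y\}+(-1)^{|x|+r}\{x,dy\}$. A *dg Poisson module* over $R$ is a unital dg $R$-module $X$ with a bilinear $\{,\}:R\times X\to X$ of degree $r$ satisfying the last three identities with $z\in X$ (respectively $y\in X$ in the last one), and $\{xy,w\}=x\{y,w\}+(-1)^{|x||y|}y\{x,w\}$.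 Morphisms are chain maps compatible with action and bracket. **Proposition.** Let $V$ be a dg vertex operator algebra. 1. The product $*$ descends to $A(V)$, and for every weak dg $V$-module $M$ the operations $*_l,*_r$ descend to bilinear maps $A(V)\times A(M)\to A(M)$ and $A(M)\times A(V)\to A(M)$. 2. $\mathrm{gr}^{[*]}A(V)$ is a dg Poisson algebra with bracket of degree $-2$ whose differential is induced by $d_V$, whose product is induced by $*$ (that is, $\widetilde a\,\widetilde b=\widetilde{a*b}$ for $a\in F^pA(V)$, $b\in F^qA(V)$, the class of $a*b$ being taken in degree $p+q$), and whose bracket is $$\{\widetilde{[u]},\widetilde{[v]}\}=[u]*[v]-(-1)^{pq}[v]*[u]\ \bmod F^{p+q-3}A(V),\qquad u\in V^{[p]},\ v\in V^{[q]},$$ where the right-hand side lies in $F^{p+q-2}A(V)$. 3. For every weak dg $V$-module $M$, $\mathrm{gr}^{[*]}A(M)$, with the differential induced by $d_M$, is a dg Poisson module over $\mathrm{gr}^{[*]}A(V)$, with the action induced by $*_l$ (that is, $\widetilde a\,\widetilde w=\widetilde{a*_lw}$ for $a\in F^pA(V)$, $w\in F^qA(M)$, in degree $p+q$) and the bracket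 of degree $-2$ $$\{\widetilde{[u]},\widetilde{[m]}\}=[u]*_l[m]-(-1)^{pq}[m]*_r[u]\ \bmod F^{p+q-3}A(M),\qquad u\in V^{[p]},\ m\in M^{[q]},$$ where the right-hand side lies in $F^{p+q-2}A(M)$. Moreover, for $\widetilde x$ of degree $p$ and $\widetilde w$ of degree $q$ with preimages $u\in V^{[p]}$ and $m\in M^{[q]}$, $$\widetilde x*_l\widetilde w=\widetilde{[u_{-1}m]}\in\mathrm{gr}^{[p+q]}A(M),\qquad\{\widetilde x,\widetilde w\}=\widetilde{[u_0m]}\in\mathrm{gr}^{[p+q-2]}A(M).$$ 4. $M\mapsto\mathrm{gr}^{[*]}A(M)$, $f\mapsto$ the induced map, with these structures, is a functor from $V\text{-Mod}^w$ to the category of dg Poisson modules over $\mathrm{gr}^{[*]}A(V)$. -/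

import Mathlib

open CategoryTheory

universe u v

noncomputable section

/-! ### Cochain complexes and their total spaces -/

/-- A cochain complex of complex vector spaces, presented by its total space
`X = ⨁ p, X^[p]` with a differential of degree one. -/
structure DGSpace where
  carrier : Type u
  [addCommGroup : AddCommGroup carrier]
  [module : Module ℂ carrier]
  /-- `deg p` is the homogeneous component of degree `p`. -/
  deg : ℤ → Submodule ℂ carrier
  isInternal : DirectSum.IsInternal deg
  /-- the differential -/
  d : carrier →ₗ[ℂ] carrier
  d_mem : ∀ (p : ℤ) (x : carrier), x ∈ deg p → d x ∈ deg (p + 1)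
  d_d : ∀ x : carrier, d (d x) = 0

namespace DGSpace

instance : CoeSort DGSpace.{u} (Type u) := ⟨DGSpace.carrier⟩

attribute [instance] DGSpace.addCommGroup DGSpace.module

/-- Chain maps, that is, linear maps of degree zero which commute with the differentials. -/
@[ext]
structure Hom (X Y : DGSpace.{u}) where
  toLin : X →ₗ[ℂ] Y
  map_deg : ∀ (p : ℤ) (x : X), x ∈ X.deg p → toLin x ∈ Y.deg p
  map_d : ∀ x : X, toLin (X.d x) = Y.d (toLin x)

instance : Category DGSpace.{u} where
  Hom := Hom
  id X := ⟨LinearMap.id, fun _ _ h => h, fun _ => rfl⟩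
  comp f g := ⟨g.toLin ∘ₗ f.toLin, fun p x h => g.map_deg p _ (f.map_deg p x h),
    fun x => by simp [f.map_d, g.map_d]⟩

/-- An eigenvector of an operator of degree zero is a sum of homogeneous eigenvectors. -/
theorem eigenspace_le (X : DGSpace.{u}) (T : X →ₗ[ℂ] X)
    (hT : ∀ (p : ℤ) (x : X), x ∈ X.deg p → T x ∈ X.deg p) (c : ℂ) :
    Module.End.eigenspace T c ≤ ⨆ p, (X.deg p ⊓ Module.End.eigenspace T c) := by
  classical
  intro x hx
  let _ := X.isInternal.chooseDecomposition
  have key : ∀ (y : X) (p : ℤ), (DirectSum.decompose X.deg (T y) p : X) =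
      T (DirectSum.decompose X.deg y p : X) := by
    intro y p
    induction y using DirectSum.Decomposition.inductionOn X.deg with
    | zero => simp
    | homogeneous y =>
      rename_i i
      rcases eq_or_ne i p with rfl | hip
      · rw [DirectSum.decompose_of_mem_same _ (hT i _ y.2),
          DirectSum.decompose_of_mem_same _ y.2]
      · rw [DirectSum.decompose_of_mem_ne _ (hT i _ y.2) hip,
          DirectSum.decompose_of_mem_ne _ y.2 hip, map_zero]
    | add y z hy hz => simp [DirectSum.decompose_add, hy, hz]
  rw [← DirectSum.sum_support_decompose X.deg x]
  refine Submodule.sum_mem _ fun p _ => ?_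
  refine Submodule.mem_iSup_of_mem p ⟨SetLike.coe_mem _, ?_⟩
  rw [Module.End.mem_eigenspace_iff] at hx
  refine Module.End.mem_eigenspace_iff.2 ?_
  rw [← key, hx, DirectSum.decompose_smul]
  rfl

end DGSpace

/-! ### dg vertex algebras, dg vertex operator algebras and their modules -/

/-- The axioms shared by the vertex operator map of a dg vertex algebra and by that of a dg
module: here `Y n u v = u_n v` are the modes on `V`, and `YM n u w = u_n w` the modes acting on
`W`, so that `Y_M(u, x) = ∑ u_n x^(-n-1)`. -/
structure IsDGVertexAction (V : DGSpace.{u}) (Y : ℤ → V →ₗ[ℂ] V →ₗ[ℂ] V) (one : V)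
    (W : DGSpace.{v}) (YM : ℤ → V →ₗ[ℂ] W →ₗ[ℂ] W) : Prop where
  /-- `Y_M(-, x)` has degree zero, where `x` has degree `-2` -/
  mode_mem : ∀ (n p q : ℤ) (u : V) (w : W), u ∈ V.deg p → w ∈ W.deg q →
    YM n u w ∈ W.deg (p + q - 2 * n - 2)
  /-- `Y_M(-, x)` commutes with the differentials -/
  d_mode : ∀ (n p : ℤ) (u : V) (w : W), u ∈ V.deg p →
    W.d (YM n u w) = YM n (V.d u) w + (-1 : ℂ) ^ (p - 2 * n - 2) • YM n u (W.d w)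
  truncation : ∀ (u : V) (w : W), ∃ N : ℤ, ∀ n, N ≤ n → YM n u w = 0
  vacuum : ∀ (n : ℤ) (w : W), YM n one w = if n = -1 then w else 0
  /-- the Jacobi identity, in components -/
  jacobi : ∀ (p q : ℤ) (u v : V) (w : W), u ∈ V.deg p → v ∈ V.deg q → ∀ l m n : ℤ,
    ∑ᶠ i : ℕ, ((-1 : ℤ) ^ i * Ring.choose l i) •
        (YM (m + l - i) u (YM (n + i) v w) -
          ((-1 : ℂ) ^ l * (-1 : ℂ) ^ (p * q)) • YM (n + l - i) v (YM (m + i) u w)) =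
      ∑ᶠ i : ℕ, Ring.choose m i • YM (m + n - i) (Y (l + i) u v) w

/-- A differential graded vertex algebra. -/
structure DGVertexAlgebra where
  space : DGSpace.{u}
  /-- `Y n u v = u_n v` -/
  Y : ℤ → space →ₗ[ℂ] space →ₗ[ℂ] space
  /-- the vacuum vector -/
  one : space
  one_mem : one ∈ space.deg 0
  d_one : space.d one = 0
  action : IsDGVertexAction space Y one space Y
  /-- the creation property -/
  creation : ∀ (v : space) (n : ℤ), 0 ≤ n → Y n v one = 0
  creation' : ∀ v : space, Y (-1) v one = v

/-- A differential graded vertex operator algebra. The weights lie in `(1/2)ℤ`; they are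
indexed by `k : ℤ`, the weight being `k / 2`. -/
structure DGVOA extends DGVertexAlgebra.{u} where
  /-- the conformal vector; `L(n) = ω_{n+1}` -/
  ω : space
  ω_mem : ω ∈ space.deg 4
  d_ω : space.d ω = 0
  /-- the central charge -/
  c : ℂ
  virasoro : ∀ (m n : ℤ) (v : space),
    Y (m + 1) ω (Y (n + 1) ω v) - Y (n + 1) ω (Y (m + 1) ω v) =
      ((m : ℂ) - n) • Y (m + n + 1) ω v +
        (if m + n = 0 then ((m : ℂ) ^ 3 - m) / 12 * c else 0) • v
  semisimple : DirectSum.IsInternal fun k : ℤ => Module.End.eigenspace (Y 1 ω) ((k : ℂ) / 2)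
  ω_weight : ω ∈ Module.End.eigenspace (Y 1 ω) 2
  finite_weight : ∀ k : ℤ, FiniteDimensional ℂ (Module.End.eigenspace (Y 1 ω) ((k : ℂ) / 2))
  bounded_weight : ∃ K : ℤ, ∀ k < K, Module.End.eigenspace (Y 1 ω) ((k : ℂ) / 2) = ⊥
  /-- `L(-1)` is the translation operator `v ↦ v_{-2} 1` -/
  translation : ∀ v : space, Y 0 ω v = Y (-2) v one

namespace DGVOA

/-- The space `V_{k/2}` of vectors of weight `k / 2`, the eigenspace of `L(0)`. -/
def wt (V : DGVOA.{u}) (k : ℤ) : Submodule ℂ V.space :=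
  Module.End.eigenspace (V.Y 1 V.ω) ((k : ℂ) / 2)

/-- A weak dg module, that is, a dg module over the underlying dg vertex algebra. -/
structure WeakModule (V : DGVOA.{u}) where
  space : DGSpace.{v}
  /-- `Y n u m = u_n m` -/
  Y : ℤ → V.space →ₗ[ℂ] space →ₗ[ℂ] space
  action : IsDGVertexAction V.space V.Y V.one space Y

/-- `V` as a module over itself. -/
def adjoint (V : DGVOA.{u}) : WeakModule.{u, u} V := ⟨V.space, V.Y, V.action⟩

end DGVOA

namespace DGVOA.WeakModule

variable {V : DGVOA.{u}}

/-- Homomorphisms of weak modules: chain maps which commute with all `v_n`. -/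
@[ext]
structure Hom (M N : WeakModule.{u, v} V) extends DGSpace.Hom M.space N.space where
  map_mode : ∀ (n : ℤ) (u : V.space) (m : M.space), toLin (M.Y n u m) = N.Y n u (toLin m)

instance : Category (WeakModule.{u, v} V) where
  Hom := Hom
  id M := ⟨𝟙 M.space, fun _ _ _ => rfl⟩
  comp {M N P} f g := ⟨(show M.space ⟶ N.space from f.toHom) ≫ (show N.space ⟶ P.space from g.toHom),
    fun n u m => (congrArg g.toLin (f.map_mode n u m)).trans (g.map_mode n u _)⟩

variable (M : WeakModule.{u, v} V)

/-- `Res_z Y_M(u, z) (1 + z)^s z^(-r) m = ∑_{n ≥ 0} (s choose n) u_{n-r} m`. -/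
def res (s : ℂ) (r : ℤ) (u : V.space) (m : M.space) : M.space :=
  ∑ᶠ n : ℕ, Ring.choose s n • M.Y (n - r) u m

/-- `u ∘ m`, for `u` of weight `k / 2`. -/
def circ (k : ℤ) (u : V.space) (m : M.space) : M.space := M.res ((k : ℂ) / 2) 2 u m

/-- `u ∗_l m`, for `u` of weight `k / 2`. -/
def starL (k : ℤ) (u : V.space) (m : M.space) : M.space := M.res ((k : ℂ) / 2) 1 u m

/-- `m ∗_r u`, for `u` of degree `p` and weight `k / 2` and `m` of degree `q`. -/
def starR (k p q : ℤ) (m : M.space) (u : V.space) : M.space :=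
  (-1 : ℂ) ^ (p * q) • M.res ((k : ℂ) / 2 - 1) 1 u m

/-- The subspace `O(M)` spanned by all `u ∘ m`. -/
def O : Submodule ℂ M.space :=
  Submodule.span ℂ {x | ∃ (k : ℤ) (u : V.space) (m : M.space), u ∈ V.wt k ∧ x = M.circ k u m}

theorem res_support (s : ℂ) (r : ℤ) (u : V.space) (m : M.space) :
    (Function.support fun n : ℕ => Ring.choose s n • M.Y (n - r) u m).Finite := by
  obtain ⟨N, hN⟩ := M.action.truncation u m
  refine (Set.finite_lt_nat (N + r).toNat).subset fun n hn => ?_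
  by_contra h
  exact hn (by
    have : N ≤ (n : ℤ) - r := by
      have h2 : ¬ n < (N + r).toNat := h
      omega
    simp [hN _ this])

theorem res_add (s : ℂ) (r : ℤ) (u u' : V.space) (m : M.space) :
    M.res s r (u + u') m = M.res s r u m + M.res s r u' m := by
  rw [res, res, res, ← finsum_add_distrib (M.res_support s r u m) (M.res_support s r u' m)]
  simp

theorem res_zero (s : ℂ) (r : ℤ) (m : M.space) : M.res s r 0 m = 0 := by
  simp [res]

theorem map_res {W : Type*} [AddCommGroup W] [Module ℂ W] (f : M.space →ₗ[ℂ] W) (s : ℂ) (r : ℤ)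
    (u : V.space) (m : M.space) :
    f (M.res s r u m) = ∑ᶠ n : ℕ, Ring.choose s n • f (M.Y (n - r) u m) := by
  rw [res, ← LinearMap.toAddMonoidHom_coe, AddMonoidHom.map_finsum _ (M.res_support s r u m)]
  simp

theorem d_res (s : ℂ) (r p : ℤ) (u : V.space) (m : M.space) (hu : u ∈ V.space.deg p) :
    M.space.d (M.res s r u m) =
      M.res s r (V.space.d u) m + (-1 : ℂ) ^ p • M.res s r u (M.space.d m) := by
  rw [map_res, res, res, smul_finsum, ← finsum_add_distrib (M.res_support s r _ m)]
  · refine finsum_congr fun n => ?_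
    rw [M.action.d_mode _ p u m hu, smul_add, smul_comm]
    have hs : (-1 : ℂ) ^ (p - 2 * ((n : ℤ) - r) - 2) = (-1 : ℂ) ^ p := by
      rw [show p - 2 * ((n : ℤ) - r) - 2 = p + 2 * (r - n - 1) by ring,
        zpow_add₀ (by norm_num), zpow_mul]
      norm_num
    rw [hs]
  · refine (M.res_support s r u (M.space.d m)).subset fun n hn h => hn ?_
    simp only at h
    simp [h]

theorem d_mem_wt (k : ℤ) (u : V.space) (hu : u ∈ V.wt k) : V.space.d u ∈ V.wt k := by
  rw [DGVOA.wt, Module.End.mem_eigenspace_iff] at *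
  have h := V.action.d_mode 1 4 V.ω u V.ω_mem
  rw [hu, V.d_ω] at h
  simpa using h.symm

theorem wt_le (k : ℤ) : V.wt k ≤ ⨆ p, (V.space.deg p ⊓ V.wt k) :=
  V.space.eigenspace_le _ (fun p x hx => by
    have := V.action.mode_mem 1 4 p V.ω x V.ω_mem hx
    rwa [show (4 : ℤ) + p - 2 * 1 - 2 = p by ring] at this) _

theorem d_mem_O (x : M.space) (hx : x ∈ M.O) : M.space.d x ∈ M.O := by
  induction hx using Submodule.span_induction with
  | zero => simp
  | add x y _ _ hx hy => rw [map_add]; exact add_mem hx hy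
  | smul c x _ hx => rw [map_smul]; exact Submodule.smul_mem _ _ hx
  | mem x hx =>
    obtain ⟨k, u, m, hu, rfl⟩ := hx
    refine Submodule.iSup_induction _ (motive := fun u => M.space.d (M.circ k u m) ∈ M.O)
      (wt_le k hu) ?_ ?_ ?_
    · rintro p u ⟨hp, hk⟩
      rw [circ, M.d_res _ _ p u m hp]
      exact add_mem (Submodule.subset_span ⟨k, _, _, d_mem_wt k u hk, rfl⟩)
        (Submodule.smul_mem _ _ (Submodule.subset_span ⟨k, _, _, hk, rfl⟩))
    · simp [circ, res_zero]
    · intro u u' h h'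
      rw [circ, res_add, map_add]
      exact add_mem h h'

/-- `A(M) = M / O(M)`; in particular `A(V)` is `V.adjoint.A`. -/
abbrev A : Type v := M.space ⧸ M.O

/-- The class `[m]` in `A(M)`. -/
abbrev cls : M.space →ₗ[ℂ] M.A := M.O.mkQ

/-- `F^p A(M)`, the image of `⨁ q ≤ p, M^[q]`. -/
def F (p : ℤ) : Submodule ℂ M.A := (⨆ q : {q : ℤ // q ≤ p}, M.space.deg q).map M.cls

/-- The operator on `A(M)` induced by the differential of `M`. -/
def dA : M.A →ₗ[ℂ] M.A := M.O.mapQ M.O M.space.d fun x hx => M.d_mem_O x hx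

theorem dA_mem (p : ℤ) (a : M.A) (ha : a ∈ M.F p) : M.dA a ∈ M.F (p + 1) := by
  obtain ⟨x, hx, rfl⟩ := ha
  refine ⟨M.space.d x, ?_, rfl⟩
  refine Submodule.iSup_induction _ (motive := fun x => M.space.d x ∈ _) hx ?_ ?_ ?_
  · intro q x hx
    exact Submodule.mem_iSup_of_mem (⟨q + 1, by have := q.2; omega⟩ : {r : ℤ // r ≤ p + 1})
      (M.space.d_mem _ _ hx)
  · simp
  · intro x y h h'
    rw [map_add]
    exact add_mem h h'

theorem dA_dA (a : M.A) : M.dA (M.dA a) = 0 := by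
  obtain ⟨x, rfl⟩ := Submodule.mkQ_surjective _ a
  simp [dA, M.space.d_d]

end DGVOA.WeakModule

/-! ### Associated graded complexes -/

namespace AssocGraded

variable {A : Type v} [AddCommGroup A] [Module ℂ A] (F : ℤ → Submodule ℂ A)

/-- `F^p / F^{p-1}` -/
def Piece (p : ℤ) : Type v := F p ⧸ (F (p - 1)).submoduleOf (F p)

instance (p : ℤ) : AddCommGroup (Piece F p) :=
  inferInstanceAs (AddCommGroup (F p ⧸ (F (p - 1)).submoduleOf (F p)))

instance (p : ℤ) : Module ℂ (Piece F p) :=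
  inferInstanceAs (Module ℂ (F p ⧸ (F (p - 1)).submoduleOf (F p)))

/-- The quotient map `F^p → F^p / F^{p-1}`. -/
def Piece.mk (p : ℤ) : F p →ₗ[ℂ] Piece F p := ((F (p - 1)).submoduleOf (F p)).mkQ

theorem Piece.mk_surjective (p : ℤ) : Function.Surjective (Piece.mk F p) :=
  Submodule.mkQ_surjective _

theorem Piece.mk_eq_zero {p : ℤ} {a : A} (h : a ∈ F p) (h' : a ∈ F (p - 1)) :
    Piece.mk F p ⟨a, h⟩ = 0 :=
  (Submodule.Quotient.mk_eq_zero ((F (p - 1)).submoduleOf (F p))).2 h'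

/-- Linear maps out of `F^p / F^{p-1}`. -/
def Piece.lift {W : Type*} [AddCommGroup W] [Module ℂ W] (p : ℤ) (f : F p →ₗ[ℂ] W)
    (hf : ∀ (a : A) (h : a ∈ F p), a ∈ F (p - 1) → f ⟨a, h⟩ = 0) : Piece F p →ₗ[ℂ] W :=
  ((F (p - 1)).submoduleOf (F p)).liftQ f fun a ha => hf a.1 a.2 ha

theorem Piece.lift_mk {W : Type*} [AddCommGroup W] [Module ℂ W] (p : ℤ) (f : F p →ₗ[ℂ] W)
    (hf : ∀ (a : A) (h : a ∈ F p), a ∈ F (p - 1) → f ⟨a, h⟩ = 0) (a : F p) :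
    Piece.lift F p f hf (Piece.mk F p a) = f a := rfl

/-- The total space `⨁ p, F^p / F^{p-1}`. -/
def Total : Type v := DirectSum ℤ (Piece F)

instance : AddCommGroup (Total F) := inferInstanceAs (AddCommGroup (DirectSum ℤ (Piece F)))

instance : Module ℂ (Total F) := inferInstanceAs (Module ℂ (DirectSum ℤ (Piece F)))

/-- The inclusion of the summand `F^p / F^{p-1}`. -/
def incl (p : ℤ) : Piece F p →ₗ[ℂ] Total F := DirectSum.lof ℂ ℤ (Piece F) p

/-- The projection to the summand `F^p / F^{p-1}`. -/
def proj (p : ℤ) : Total F →ₗ[ℂ] Piece F p := DirectSum.component ℂ ℤ (Piece F) p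

theorem proj_incl_self (p : ℤ) (x : Piece F p) : proj F p (incl F p x) = x :=
  DirectSum.component.lof_self ℂ p x

theorem proj_incl_ne {p q : ℤ} (h : q ≠ p) (x : Piece F q) : proj F p (incl F q x) = 0 :=
  (DirectSum.component.of ℂ p q x).trans (dif_neg h)

/-- Linear maps out of the total space. -/
def lift {W : Type*} [AddCommGroup W] [Module ℂ W] (f : ∀ p, Piece F p →ₗ[ℂ] W) :
    Total F →ₗ[ℂ] W :=
  DirectSum.toModule ℂ ℤ W f

theorem lift_incl {W : Type*} [AddCommGroup W] [Module ℂ W] (f : ∀ p, Piece F p →ₗ[ℂ] W)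
    (p : ℤ) (x : Piece F p) : lift F f (incl F p x) = f p x :=
  DirectSum.toModule_lof ℂ p x

theorem Total.induction {motive : Total F → Prop} (x : Total F) (zero : motive 0)
    (incl : ∀ p y, motive (incl F p y)) (add : ∀ y z, motive y → motive z → motive (y + z)) :
    motive x :=
  DirectSum.induction_on (motive := motive) x zero incl add

/-- The class of an element of `F^p` in `F^p / F^{p-1}`, as an element of the total space. -/
def symb (p : ℤ) : F p →ₗ[ℂ] Total F := incl F p ∘ₗ Piece.mk F p

/-- `x` is the class modulo `F^{p-1}` of the element `a` of `F^p`. -/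
def IsSymb (p : ℤ) (a : A) (x : Total F) : Prop := ∃ h : a ∈ F p, symb F p ⟨a, h⟩ = x

theorem symb_eq_zero {p : ℤ} {a : A} (h : a ∈ F p) (h' : a ∈ F (p - 1)) :
    symb F p ⟨a, h⟩ = 0 := by
  rw [symb, LinearMap.comp_apply, Piece.mk_eq_zero F h h', map_zero]

theorem ext_symb {W : Type*} [AddCommGroup W] [Module ℂ W] {f g : Total F →ₗ[ℂ] W}
    (h : ∀ (p : ℤ) (a : A) (ha : a ∈ F p), f (symb F p ⟨a, ha⟩) = g (symb F p ⟨a, ha⟩)) :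
    f = g := by
  refine LinearMap.ext fun x => ?_
  induction x using Total.induction F with
  | zero => simp
  | incl p y =>
    obtain ⟨⟨a, ha⟩, rfl⟩ := Piece.mk_surjective F p y
    exact h p a ha
  | add y z hy hz => rw [map_add, map_add, hy, hz]

/-- The map induced on associated graded spaces by a linear map which shifts the filtration by
at most `r`. -/
def map {B : Type v} [AddCommGroup B] [Module ℂ B] (G : ℤ → Submodule ℂ B) (r : ℤ)
    (f : A →ₗ[ℂ] B) (hf : ∀ p a, a ∈ F p → f a ∈ G (p + r)) : Total F →ₗ[ℂ] Total G :=
  lift F fun p => Piece.lift F p (symb G (p + r) ∘ₗ f.restrict (hf p)) fun a h h' =>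
    (symb_eq_zero G (hf p a h) (by
      have := hf (p - 1) a h'
      rwa [show p - 1 + r = p + r - 1 by ring] at this) :)

theorem map_symb {B : Type v} [AddCommGroup B] [Module ℂ B] (G : ℤ → Submodule ℂ B) (r : ℤ)
    (f : A →ₗ[ℂ] B) (hf : ∀ p a, a ∈ F p → f a ∈ G (p + r)) (p : ℤ) (a : A) (ha : a ∈ F p) :
    map F G r f hf (symb F p ⟨a, ha⟩) = symb G (p + r) ⟨f a, hf p a ha⟩ := by
  rw [map, symb, LinearMap.comp_apply, lift_incl]
  rfl

theorem symb_congr {p q : ℤ} (h : p = q) {a b : A} (hab : a = b) (ha : a ∈ F p) (hb : b ∈ F q) :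
    symb F p ⟨a, ha⟩ = symb F q ⟨b, hb⟩ := by
  subst h; subst hab; rfl

/-- The homogeneous component of degree `p` of the associated graded space. -/
def deg (p : ℤ) : Submodule ℂ (Total F) := LinearMap.range (symb F p)

theorem map_mem_deg {B : Type v} [AddCommGroup B] [Module ℂ B] (G : ℤ → Submodule ℂ B) (r : ℤ)
    (f : A →ₗ[ℂ] B) (hf : ∀ p a, a ∈ F p → f a ∈ G (p + r)) (p : ℤ) (x : Total F)
    (hx : x ∈ deg F p) : map F G r f hf x ∈ deg G (p + r) := by
  obtain ⟨⟨a, ha⟩, rfl⟩ := hx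
  rw [map_symb]
  exact ⟨_, rfl⟩

theorem isInternal : DirectSum.IsInternal (deg F) := by
  refine DirectSum.isInternal_submodule_of_iSupIndep_of_iSup_eq_top ?_ ?_
  · intro p
    rw [Submodule.disjoint_def]
    rintro _ ⟨y, rfl⟩ h
    have hle : (⨆ (j : ℤ) (_ : j ≠ p), deg F j) ≤ LinearMap.ker (proj F p) := by
      refine iSup₂_le fun j hj => ?_
      rintro _ ⟨z, rfl⟩
      exact proj_incl_ne F hj _
    have h0 := hle h
    rw [LinearMap.mem_ker, symb, LinearMap.comp_apply, proj_incl_self] at h0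
    rw [symb, LinearMap.comp_apply, h0, map_zero]
  · rw [eq_top_iff]
    rintro x -
    induction x using Total.induction F with
    | zero => exact zero_mem _
    | incl p y =>
      obtain ⟨z, rfl⟩ := Piece.mk_surjective F p y
      exact Submodule.mem_iSup_of_mem p ⟨z, rfl⟩
    | add x y hx hy => exact add_mem hx hy

/-- The complex `gr^[*] A` of a filtered space with a differential. -/
def complex (d : A →ₗ[ℂ] A) (hd : ∀ p a, a ∈ F p → d a ∈ F (p + 1)) (hdd : ∀ a, d (d a) = 0) :
    DGSpace.{v} where
  carrier := Total F
  deg := deg F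
  isInternal := isInternal F
  d := map F F 1 d hd
  d_mem := map_mem_deg F F 1 d hd
  d_d := fun x => by
    have : map F F 1 d hd ∘ₗ map F F 1 d hd = 0 := ext_symb F fun p a ha => by
      rw [LinearMap.comp_apply, map_symb, map_symb]
      exact symb_eq_zero F _ (by rw [hdd]; exact zero_mem _)
    exact LinearMap.congr_fun this x

end AssocGraded

namespace DGVOA.WeakModule

variable {V : DGVOA.{u}} (M : WeakModule.{u, v} V)

/-- The complex `gr^[*] A(M)`, with the differential induced by that of `M`. -/
def gr : DGSpace.{v} := AssocGraded.complex M.F M.dA M.dA_mem M.dA_dA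

/-- `M.IsSymb p a x`: the element `x` of `gr^[*] A(M)` is the class, in the component of
degree `p`, of the element `a` of `F^p A(M)`. -/
def IsSymb (p : ℤ) (a : M.A) (x : M.gr) : Prop := AssocGraded.IsSymb M.F p a x

variable {M} {N P : WeakModule.{u, v} V}

theorem Hom.map_O (f : Hom M N) : M.O ≤ N.O.comap f.toLin := by
  refine Submodule.span_le.2 ?_
  rintro _ ⟨k, u, m, hu, rfl⟩
  refine Submodule.subset_span ⟨k, u, f.toLin m, hu, ?_⟩
  rw [circ, map_res]
  simp only [f.map_mode]
  rfl

/-- The map `A(M) → A(N)` induced by a homomorphism `M → N`. -/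
def Hom.mapA (f : Hom M N) : M.A →ₗ[ℂ] N.A := M.O.mapQ N.O f.toLin f.map_O

theorem Hom.mapA_mem (f : Hom M N) (p : ℤ) (a : M.A) (ha : a ∈ M.F p) :
    f.mapA a ∈ N.F (p + 0) := by
  rw [add_zero]
  obtain ⟨x, hx, rfl⟩ := ha
  refine ⟨f.toLin x, ?_, rfl⟩
  refine Submodule.iSup_induction _ (motive := fun x => f.toLin x ∈ _) hx ?_ ?_ ?_
  · intro q x hx
    exact Submodule.mem_iSup_of_mem q (f.map_deg _ _ hx)
  · simp
  · intro x y h h'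
    rw [map_add]
    exact add_mem h h'

/-- The chain map `gr^[*] A(M) → gr^[*] A(N)` induced by a homomorphism `M → N`. -/
def Hom.mapGr (f : Hom M N) : DGSpace.Hom M.gr N.gr where
  toLin := AssocGraded.map M.F N.F 0 f.mapA f.mapA_mem
  map_deg := fun p x hx => by
    have := AssocGraded.map_mem_deg M.F N.F 0 f.mapA f.mapA_mem p x hx
    rwa [add_zero] at this
  map_d := fun x => by
    refine LinearMap.congr_fun (f := AssocGraded.map M.F N.F 0 f.mapA f.mapA_mem ∘ₗ
      AssocGraded.map M.F M.F 1 M.dA M.dA_mem) (g := AssocGraded.map N.F N.F 1 N.dA N.dA_mem ∘ₗ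
      AssocGraded.map M.F N.F 0 f.mapA f.mapA_mem) (AssocGraded.ext_symb M.F fun p a ha => ?_) x
    simp only [LinearMap.comp_apply, AssocGraded.map_symb]
    refine AssocGraded.symb_congr _ (by ring) ?_ _ _
    obtain ⟨x, rfl⟩ := Submodule.mkQ_surjective _ a
    simp [Hom.mapA, dA, f.map_d]

variable (V) in
/-- The functor `M ↦ gr^[*] A(M)` from weak modules to complexes. -/
def grFunctor : WeakModule.{u, v} V ⥤ DGSpace.{v} where
  obj M := M.gr
  map f := Hom.mapGr f
  map_id M := by
    refine DGSpace.Hom.ext (AssocGraded.ext_symb M.F fun p a ha => ?_)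
    refine (AssocGraded.map_symb M.F M.F 0 _ (Hom.mapA_mem (𝟙 M)) p a ha).trans ?_
    refine AssocGraded.symb_congr _ (by ring) ?_ _ _
    obtain ⟨x, rfl⟩ := Submodule.mkQ_surjective _ a
    rfl
  map_comp {M N P} f g := by
    refine DGSpace.Hom.ext (AssocGraded.ext_symb M.F fun p a ha => ?_)
    refine (AssocGraded.map_symb M.F P.F 0 _ (Hom.mapA_mem (f ≫ g)) p a ha).trans ?_
    refine Eq.trans ?_ (congrArg (AssocGraded.map N.F P.F 0 (Hom.mapA g) (Hom.mapA_mem g))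
      (AssocGraded.map_symb M.F N.F 0 _ (Hom.mapA_mem f) p a ha)).symm
    rw [AssocGraded.map_symb]
    refine AssocGraded.symb_congr _ (by ring) ?_ _ _
    obtain ⟨x, rfl⟩ := Submodule.mkQ_surjective _ a
    rfl

end DGVOA.WeakModule

/-! ### dg Poisson algebras and dg Poisson modules -/

/-- The structure, on the complex `R`, of a graded commutative (associative, unital) dg Poisson
algebra with Poisson bracket of degree `r`. -/
structure DGPoissonAlgebra (R : DGSpace.{u}) (r : ℤ) where
  mul : R →ₗ[ℂ] R →ₗ[ℂ] R
  one : R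
  bracket : R →ₗ[ℂ] R →ₗ[ℂ] R
  mul_mem : ∀ (p q : ℤ) (x y : R), x ∈ R.deg p → y ∈ R.deg q → mul x y ∈ R.deg (p + q)
  one_mem : one ∈ R.deg 0
  mul_assoc : ∀ x y z : R, mul (mul x y) z = mul x (mul y z)
  one_mul : ∀ x : R, mul one x = x
  mul_one : ∀ x : R, mul x one = x
  mul_comm : ∀ (p q : ℤ) (x y : R), x ∈ R.deg p → y ∈ R.deg q →
    mul x y = (-1 : ℂ) ^ (p * q) • mul y x
  d_mul : ∀ (p : ℤ) (x y : R), x ∈ R.deg p →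
    R.d (mul x y) = mul (R.d x) y + (-1 : ℂ) ^ p • mul x (R.d y)
  bracket_mem : ∀ (p q : ℤ) (x y : R), x ∈ R.deg p → y ∈ R.deg q →
    bracket x y ∈ R.deg (p + q + r)
  bracket_skew : ∀ (p q : ℤ) (x y : R), x ∈ R.deg p → y ∈ R.deg q →
    bracket x y = -((-1 : ℂ) ^ ((p + r) * (q + r)) • bracket y x)
  bracket_jacobi : ∀ (p q : ℤ) (x y z : R), x ∈ R.deg p → y ∈ R.deg q →
    bracket x (bracket y z) =
      bracket (bracket x y) z + (-1 : ℂ) ^ ((p + r) * (q + r)) • bracket y (bracket x z)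
  bracket_mul : ∀ (p q : ℤ) (x y z : R), x ∈ R.deg p → y ∈ R.deg q →
    bracket x (mul y z) =
      mul (bracket x y) z + (-1 : ℂ) ^ ((p + r) * q) • mul y (bracket x z)
  /-- the bracket is a cocycle of degree `r` -/
  d_bracket : ∀ (p : ℤ) (x y : R), x ∈ R.deg p →
    R.d (bracket x y) =
      (-1 : ℂ) ^ r • bracket (R.d x) y + (-1 : ℂ) ^ (p + r) • bracket x (R.d y)

/-- The structure, on the complex `X`, of a dg Poisson module over a dg Poisson algebra. -/
structure DGPoissonModuleStr {R : DGSpace.{u}} {r : ℤ} (S : DGPoissonAlgebra R r)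
    (X : DGSpace.{v}) where
  act : R →ₗ[ℂ] X →ₗ[ℂ] X
  bracket : R →ₗ[ℂ] X →ₗ[ℂ] X
  act_mem : ∀ (p q : ℤ) (x : R) (w : X), x ∈ R.deg p → w ∈ X.deg q → act x w ∈ X.deg (p + q)
  mul_act : ∀ (x y : R) (w : X), act (S.mul x y) w = act x (act y w)
  one_act : ∀ w : X, act S.one w = w
  d_act : ∀ (p : ℤ) (x : R) (w : X), x ∈ R.deg p →
    X.d (act x w) = act (R.d x) w + (-1 : ℂ) ^ p • act x (X.d w)
  bracket_mem : ∀ (p q : ℤ) (x : R) (w : X), x ∈ R.deg p → w ∈ X.deg q →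
    bracket x w ∈ X.deg (p + q + r)
  bracket_jacobi : ∀ (p q : ℤ) (x y : R) (w : X), x ∈ R.deg p → y ∈ R.deg q →
    bracket x (bracket y w) =
      bracket (S.bracket x y) w + (-1 : ℂ) ^ ((p + r) * (q + r)) • bracket y (bracket x w)
  d_bracket : ∀ (p : ℤ) (x : R) (w : X), x ∈ R.deg p →
    X.d (bracket x w) =
      (-1 : ℂ) ^ r • bracket (R.d x) w + (-1 : ℂ) ^ (p + r) • bracket x (X.d w)
  bracket_act : ∀ (p q : ℤ) (x y : R) (w : X), x ∈ R.deg p → y ∈ R.deg q →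
    bracket x (act y w) =
      act (S.bracket x y) w + (-1 : ℂ) ^ ((p + r) * q) • act y (bracket x w)
  mul_bracket : ∀ (p q : ℤ) (x y : R) (w : X), x ∈ R.deg p → y ∈ R.deg q →
    bracket (S.mul x y) w = act x (bracket y w) + (-1 : ℂ) ^ (p * q) • act y (bracket x w)

/-- The objects of the category of dg Poisson modules. -/
structure DGPoissonModule {R : DGSpace.{u}} {r : ℤ} (S : DGPoissonAlgebra R r) where
  space : DGSpace.{v}
  str : DGPoissonModuleStr S space

namespace DGPoissonModule

variable {R : DGSpace.{u}} {r : ℤ} {S : DGPoissonAlgebra R r}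

/-- Homomorphisms of dg Poisson modules: chain maps compatible with actions and brackets. -/
@[ext]
structure Hom (X Y : DGPoissonModule.{u, v} S) extends DGSpace.Hom X.space Y.space where
  map_act : ∀ (x : R) (w : X.space), toLin (X.str.act x w) = Y.str.act x (toLin w)
  map_bracket : ∀ (x : R) (w : X.space), toLin (X.str.bracket x w) = Y.str.bracket x (toLin w)

instance : Category (DGPoissonModule.{u, v} S) where
  Hom := Hom
  id X := ⟨𝟙 X.space, fun _ _ => rfl, fun _ _ => rfl⟩
  comp {X Y Z} f g := ⟨(show X.space ⟶ Y.space from f.toHom) ≫ (show Y.space ⟶ Z.space from g.toHom),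
    fun x w => (congrArg g.toLin (f.map_act x w)).trans (g.map_act x _),
    fun x w => (congrArg g.toLin (f.map_bracket x w)).trans (g.map_bracket x _)⟩

variable (S) in
/-- The functor which forgets action and bracket. -/
def forgetToDGSpace : DGPoissonModule.{u, v} S ⥤ DGSpace.{v} where
  obj X := X.space
  map f := Hom.toHom f

end DGPoissonModule

/-! ### The operations on `A(M)` induced by `∗_l` and `∗_r` -/

namespace DGVOA.WeakModule

variable {V : DGVOA.{u}} (M : WeakModule.{u, v} V)

/-- The bilinear map `A(V) × A(M) → A(M)` is induced by `∗_l`. -/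
def IsLeftProduct (l : V.adjoint.A →ₗ[ℂ] M.A →ₗ[ℂ] M.A) : Prop :=
  ∀ (k : ℤ) (u : V.space) (m : M.space), u ∈ V.wt k →
    l (V.adjoint.cls u) (M.cls m) = M.cls (M.starL k u m)

/-- The bilinear map `A(M) × A(V) → A(M)` is induced by `∗_r`. -/
def IsRightProduct (ρ : M.A →ₗ[ℂ] V.adjoint.A →ₗ[ℂ] M.A) : Prop :=
  ∀ (k p q : ℤ) (u : V.space) (m : M.space), u ∈ V.space.deg p → u ∈ V.wt k →
    m ∈ M.space.deg q → ρ (M.cls m) (V.adjoint.cls u) = M.cls (M.starR k p q m u)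

end DGVOA.WeakModule

end

/-! All operations are residues Res_z F(z) z^(-r) Y(u,z)m with F a power series. For u of weight h,
`∘` has r = 2 and F = (1+z)^h, while `∗_l` and `∗_r` (up to its sign) have r = 1 and F = (1+z)^h,
respectively F = (1+z)^(h-1). Two facts about such residues carry the proof.

The first is Zhu's lemma (`residue_mem_O_of_le`): the residue with F = (1+z)^(h+j) and r = 2+n lies
in O(M) whenever 0 ≤ j ≤ n. Together with the Jacobi identity tested against power series
(`jacobi_residue`) it shows that both operations preserve O(M), send O(V) × M into O(M), and
supercommute with each other modulo O(M). Hence they descend to A(M). Supercommutation evaluated on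
the vacuum identifies, up to sign, the right action on A(V) with the product in opposite order. So
`comm`, the difference of the two unsigned operations, is the supercommutator on A(V), which gives
graded commutativity and skew-symmetry.

The second is a count of degrees. Since u_n m has degree |u|+|m|-2n-2, a residue of order r has
leading mode u_{-r}m, and each further mode lies two degrees lower. Thus `∗_l` is u_{-1}m to leading
order, and the two operations differ by a residue of order 0, which is u_0 m to leading order.
Moreover u_{-2-n}m, for n ≥ 0, is the leading mode of an element of O(M), so modes of index at most
-2 vanish in gr A(M).

Consequently the symbol map `total` from M onto gr A(M) turns action and bracket into the modes -1
and 0 and kills all lower modes. The Poisson identities are then the cases l = 0 and l = -1 of the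
Jacobi identity, where nearly all terms disappear, and functoriality holds because morphisms commute
with modes. -/

noncomputable section

/-! ### Linear maps on internal direct sums -/

/-- The linear map on an internal direct sum with given restrictions to the summands. -/
def DirectSum.IsInternal.glue {X Y : Type*} [AddCommGroup X] [Module ℂ X] [AddCommGroup Y]
    [Module ℂ Y] {W : ℤ → Submodule ℂ X} (h : DirectSum.IsInternal W)
    (f : ∀ i, W i →ₗ[ℂ] Y) : X →ₗ[ℂ] Y :=
  DirectSum.toModule ℂ ℤ Y f ∘ₗ
    (LinearEquiv.ofBijective (DirectSum.coeLinearMap W) h).symm.toLinearMap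

theorem DirectSum.IsInternal.glue_apply {X Y : Type*} [AddCommGroup X] [Module ℂ X]
    [AddCommGroup Y] [Module ℂ Y] {W : ℤ → Submodule ℂ X} (h : DirectSum.IsInternal W)
    (f : ∀ i, W i →ₗ[ℂ] Y) {i : ℤ} {x : X} (hx : x ∈ W i) : h.glue f x = f i ⟨x, hx⟩ := by
  have : (LinearEquiv.ofBijective (DirectSum.coeLinearMap W) h).symm x =
      DirectSum.lof ℂ ℤ (fun i => W i) i ⟨x, hx⟩ := by
    refine (LinearEquiv.symm_apply_eq _).2 ?_
    exact (DirectSum.coeLinearMap_lof W i ⟨x, hx⟩).symm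
  rw [DirectSum.IsInternal.glue, LinearMap.comp_apply, LinearEquiv.coe_coe, this,
    DirectSum.toModule_lof]

theorem DirectSum.IsInternal.induction {X : Type*} [AddCommGroup X] [Module ℂ X]
    {W : ℤ → Submodule ℂ X} (h : DirectSum.IsInternal W) {motive : X → Prop} (x : X)
    (mem : ∀ i, ∀ y ∈ W i, motive y) (zero : motive 0)
    (add : ∀ y z, motive y → motive z → motive (y + z)) : motive x :=
  Submodule.iSup_induction W (motive := motive)
    (h.submodule_iSup_eq_top ▸ Submodule.mem_top : x ∈ iSup W) mem zero add

/-! ### Residues against formal power series -/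

namespace DGVOA.WeakModule

open PowerSeries Filter

variable {V : DGVOA.{u}} (M : WeakModule.{u, v} V)

theorem residue_support (r : ℤ) (F : ℂ⟦X⟧) (u : V.space) (m : M.space) :
    (Function.support fun n : ℕ => coeff n F • M.Y (n - r) u m).Finite := by
  obtain ⟨N, hN⟩ := M.action.truncation u m
  refine (Set.finite_lt_nat (N + r).toNat).subset fun n hn => ?_
  by_contra h
  refine hn ?_
  have : N ≤ (n : ℤ) - r := by
    have h2 : ¬ n < (N + r).toNat := h
    omega
  simp [hN _ this]

/-- `M.residue r F u m = Res_z F(z) z^(-r) Y_M(u, z) m`. -/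
def residue (r : ℤ) : ℂ⟦X⟧ →ₗ[ℂ] V.space →ₗ[ℂ] M.space →ₗ[ℂ] M.space :=
  LinearMap.mk₂ ℂ
    (fun F u =>
      { toFun := fun m => ∑ᶠ n : ℕ, coeff n F • M.Y (n - r) u m
        map_add' := fun m m' => by
          rw [← finsum_add_distrib (M.residue_support r F u m) (M.residue_support r F u m')]
          simp
        map_smul' := fun c m => by
          rw [RingHom.id_apply, smul_finsum]
          simp only [map_smul, smul_comm c] })
    (fun F F' u => LinearMap.ext fun m => by
      refine Eq.trans ?_ (finsum_add_distrib (M.residue_support r F u m)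
        (M.residue_support r F' u m))
      simp [add_smul])
    (fun c F u => LinearMap.ext fun m => by
      refine Eq.trans ?_ (smul_finsum c _).symm
      simp [mul_smul])
    (fun F u u' => LinearMap.ext fun m => by
      refine Eq.trans ?_ (finsum_add_distrib (M.residue_support r F u m)
        (M.residue_support r F u' m))
      simp)
    (fun c F u => LinearMap.ext fun m => by
      refine Eq.trans ?_ (smul_finsum c _).symm
      simp [smul_comm c])

theorem residue_apply (r : ℤ) (F : ℂ⟦X⟧) (u : V.space) (m : M.space) :
    M.residue r F u m = ∑ᶠ n : ℕ, coeff n F • M.Y (n - r) u m := rfl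

theorem res_eq_residue (s : ℂ) (r : ℤ) (u : V.space) (m : M.space) :
    M.res s r u m = M.residue r (binomialSeries ℂ s) u m := by
  simp [residue_apply, res]

theorem residue_X_pow (r : ℤ) (a : ℕ) (u : V.space) (m : M.space) :
    M.residue r (X ^ a) u m = M.Y (a - r) u m := by
  rw [residue_apply, finsum_eq_single _ a fun n hn => by simp [coeff_X_pow, hn]]
  simp

theorem residue_X_pow_mul (r : ℤ) (a : ℕ) (F : ℂ⟦X⟧) (u : V.space) (m : M.space) :
    M.residue r (X ^ a * F) u m = M.residue (r - a) F u m := by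
  have hsupp : (Function.support fun n : ℕ => coeff n (X ^ a * F) • M.Y (n - r) u m) ⊆
      Set.range fun n : ℕ => n + a := fun n hn => by
    by_contra h
    refine hn ?_
    have : ¬ a ≤ n := fun h' => h ⟨n - a, by simp [h']⟩
    simp [coeff_X_pow_mul', this]
  rw [residue_apply, residue_apply, ← Set.indicator_eq_self.2 hsupp]
  refine (finsum_mem_def _ _).symm.trans ((finsum_mem_range (add_left_injective a)).trans ?_)
  refine finsum_congr fun n => ?_
  rw [coeff_X_pow_mul', if_pos (by omega), Nat.add_sub_cancel,
    show ((n + a : ℕ) : ℤ) - r = n - (r - a) by push_cast; ring]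

theorem eventually_Y_eq_zero (u : V.space) (m : M.space) :
    ∀ᶠ n in atTop, M.Y n u m = 0 := by
  obtain ⟨N, hN⟩ := M.action.truncation u m
  exact eventually_atTop.2 ⟨N, hN⟩

theorem eventually_residue_eq_zero (u : V.space) (m : M.space) :
    ∀ᶠ r in atTop, ∀ F, M.residue (-r) F u m = 0 := by
  obtain ⟨N, hN⟩ := M.action.truncation u m
  refine eventually_atTop.2 ⟨N, fun r hr F => ?_⟩
  rw [residue_apply]
  refine finsum_eq_zero_of_forall_eq_zero fun n => ?_
  rw [hN _ (by omega), smul_zero]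

theorem tendsto_natCast_sub (r : ℤ) : Tendsto (fun n : ℕ => (n : ℤ) - r) atTop atTop :=
  tendsto_atTop_add_const_right _ (-r) tendsto_natCast_atTop_atTop

/-- Truncation makes residues continuous for the X-adic topology, uniformly in the series; this
permits checking identities on monomials. -/
theorem eventually_residue_X_pow_mul (r : ℤ) (u : V.space) (m : M.space) :
    ∀ᶠ a : ℕ in atTop, ∀ F, M.residue r (X ^ a * F) u m = 0 := by
  filter_upwards [(tendsto_natCast_sub r).eventually (M.eventually_residue_eq_zero u m)]
    with a ha F
  rw [residue_X_pow_mul, ← ha F, neg_sub]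

/-- A linear map on formal power series which is continuous for the `X`-adic topology vanishes
if it vanishes on monomials. -/
theorem eq_zero_of_X_pow {W : Type*} [AddCommGroup W] [Module ℂ W] (f : ℂ⟦X⟧ →ₗ[ℂ] W)
    (hf : ∀ᶠ a : ℕ in atTop, ∀ F, f (X ^ a * F) = 0) (h : ∀ a : ℕ, f (X ^ a) = 0) : f = 0 := by
  obtain ⟨N, hN⟩ := hf.exists
  refine LinearMap.ext fun F => ?_
  rw [eq_X_pow_mul_shift_add_trunc N F, map_add, hN, zero_add, LinearMap.zero_apply]
  generalize trunc N F = p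
  induction p using Polynomial.induction_on' with
  | add p q hp hq => rw [Polynomial.coe_add, map_add, hp, hq, add_zero]
  | monomial n c =>
    rw [Polynomial.coe_monomial, monomial_eq_C_mul_X_pow, ← smul_eq_C_mul, map_smul, h, smul_zero]

/-! ### Translation covariance and weights of modes -/

theorem choose_neg_two (i : ℕ) : (-1 : ℤ) ^ i * Ring.choose (-2 : ℤ) i = i + 1 := by
  rw [Ring.choose_neg, show (2 : ℤ) + i - 1 = ((i + 1 : ℕ) : ℤ) by push_cast; ring,
    Ring.choose_natCast, Nat.choose_succ_self_right, Units.smul_def, smul_eq_mul, ← mul_assoc,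
    Int.coe_negOnePow_natCast, ← mul_pow]
  simp

/-- By the Jacobi identity for x and the vacuum with l = -2, m = 0, where L(-1)x = x_{-2}1. The
modes of the vacuum leave one term: from the first summand if n < 0, from the second if n > 0, and
none if n = 0. -/
theorem Y_translation (n : ℤ) (x : V.space) (w : M.space) :
    M.Y n (V.Y 0 V.ω x) w = -(n : ℂ) • M.Y (n - 1) x w := by
  rw [V.translation]
  refine V.space.isInternal.induction (motive := fun x =>
    M.Y n (V.Y (-2) x V.one) w = -(n : ℂ) • M.Y (n - 1) x w) x ?_ (by simp) ?_
  · intro p x hx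
    have h := M.action.jacobi p 0 x V.one w hx V.one_mem (-2) 0 n
    rw [finsum_eq_single (fun i : ℕ => Ring.choose (0 : ℤ) i • _) 0 fun i hi => by
      rw [Ring.choose_zero_pos _ (Nat.pos_of_ne_zero hi), zero_smul]] at h
    simp only [Ring.choose_zero_right, one_smul, Nat.cast_zero, zero_add, sub_zero, add_zero] at h
    rw [← h]
    simp only [choose_neg_two, M.action.vacuum]
    rcases lt_trichotomy n 0 with hn | rfl | hn
    · rw [finsum_eq_single _ (-n - 1).toNat fun i hi => by
        rw [if_neg (by omega), if_neg (by omega)]; simp]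
      rw [if_pos (by omega), if_neg (by omega), show (((-n - 1).toNat : ℕ) : ℤ) = -n - 1 by omega,
        ← Int.cast_smul_eq_zsmul ℂ, show (-2 : ℤ) - (-n - 1) = n - 1 by ring]
      simp
    · rw [finsum_eq_zero_of_forall_eq_zero fun i => by
        rw [if_neg (by omega), if_neg (by omega)]; simp]
      simp
    · rw [finsum_eq_single _ (n - 1).toNat fun i hi => by
        rw [if_neg (by omega), if_neg (by omega)]; simp]
      rw [if_neg (by omega), if_pos (by omega), show (((n - 1).toNat : ℕ) : ℤ) = n - 1 by omega,
        ← Int.cast_smul_eq_zsmul ℂ]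
      simp
  · intro y z hy hz
    simp [hy, hz]

theorem mem_wt {k : ℤ} {x : V.space} : x ∈ V.wt k ↔ V.Y 1 V.ω x = ((k : ℂ) / 2) • x :=
  Module.End.mem_eigenspace_iff

theorem wt_induction {k : ℤ} {motive : V.space → Prop} {x : V.space} (hx : x ∈ V.wt k)
    (mem : ∀ p, ∀ y ∈ V.space.deg p, y ∈ V.wt k → motive y) (zero : motive 0)
    (add : ∀ y z, motive y → motive z → motive (y + z)) : motive x :=
  Submodule.iSup_induction _ (motive := motive) (wt_le k hx) (fun p y hy => mem p y hy.1 hy.2)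
    zero add

/-- The Jacobi identity for ω and x with l = 0, m = 1 leaves (L(-1)x)_{n+1} + (L(0)x)_n on the
right, and translation covariance evaluates the first term. No sign enters because ω has even
degree. -/
theorem L_zero_mode (n : ℤ) {k : ℤ} {x : V.space} (hx : x ∈ V.wt k) (w : M.space) :
    M.Y 1 V.ω (M.Y n x w) = M.Y n x (M.Y 1 V.ω w) + ((k : ℂ) / 2 - n - 1) • M.Y n x w := by
  refine wt_induction (motive := fun x => M.Y 1 V.ω (M.Y n x w) =
    M.Y n x (M.Y 1 V.ω w) + ((k : ℂ) / 2 - n - 1) • M.Y n x w) hx ?_ (by simp) ?_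
  · intro p x hp hx
    have h := M.action.jacobi 4 p V.ω x w V.ω_mem hp 0 1 n
    rw [finsum_eq_single _ 0 fun i hi => by rw [Ring.choose_zero_pos _ (Nat.pos_of_ne_zero hi)]; simp,
      finsum_eq_sum_of_support_subset (s := Finset.range 2) _ fun i hi => by
        by_contra h
        refine hi ?_
        have h2 : 1 < i := by simpa using h
        have := Ring.choose_natCast (R := ℤ) 1 i
        rw [Nat.choose_eq_zero_of_lt h2] at this
        simp only [Nat.cast_one, Nat.cast_zero] at this
        simp [this]] at h
    have h4 : (-1 : ℂ) ^ (4 * p) = 1 := by rw [zpow_mul]; norm_num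
    simp only [Finset.sum_range_succ, Finset.sum_range_zero, h4, Ring.choose_zero_right,
      Ring.choose_one_right, Nat.cast_zero, Nat.cast_one, pow_zero, one_smul, mul_one, zpow_zero,
      add_zero, sub_zero, zero_add, Y_translation, add_sub_cancel_left, mem_wt.1 hx, map_smul,
      LinearMap.smul_apply] at h
    rw [sub_eq_iff_eq_add] at h
    rw [h]
    push_cast
    module
  · intro y z hy hz
    simp only [map_add, LinearMap.add_apply, hy, hz, smul_add]
    abel

theorem mode_mem_wt (n : ℤ) {k l : ℤ} {x y : V.space} (hx : x ∈ V.wt k) (hy : y ∈ V.wt l) :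
    V.Y n x y ∈ V.wt (k + l - 2 * n - 2) := by
  have h : V.Y 1 V.ω (V.Y n x y) =
      V.Y n x (V.Y 1 V.ω y) + ((k : ℂ) / 2 - n - 1) • V.Y n x y := V.adjoint.L_zero_mode n hx y
  rw [mem_wt, h, mem_wt.1 hy, map_smul, ← add_smul]
  push_cast
  congr 1
  ring

theorem translation_mem_wt {k : ℤ} {x : V.space} (hx : x ∈ V.wt k) :
    V.Y 0 V.ω x ∈ V.wt (k + 2) := by
  have hω : V.ω ∈ V.wt 4 := by
    rw [DGVOA.wt, show ((4 : ℤ) : ℂ) / 2 = 2 by norm_num]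
    exact V.ω_weight
  have h := mode_mem_wt 0 hω hx
  rwa [show 4 + k - 2 * 0 - 2 = k + 2 by ring] at h

/-! ### The Jacobi identity for residues against formal power series -/

/-- The operator on power series such that `hasse r i F` is `z^(r+i)` times the `i`-th Hasse
derivative of `z^(-r) F(z)`. -/
def hasse (r : ℤ) (i : ℕ) : ℂ⟦X⟧ →ₗ[ℂ] ℂ⟦X⟧ where
  toFun F := PowerSeries.mk fun n : ℕ => ((Ring.choose ((n : ℤ) - r) i : ℤ) : ℂ) * coeff n F
  map_add' F G := by ext; simp [mul_add]
  map_smul' c F := by ext; simp [mul_left_comm]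

theorem coeff_hasse (r : ℤ) (i n : ℕ) (F : ℂ⟦X⟧) :
    coeff n (hasse r i F) = ((Ring.choose ((n : ℤ) - r) i : ℤ) : ℂ) * coeff n F := by
  simp [hasse]

theorem hasse_X_pow_mul (r : ℤ) (i a : ℕ) (F : ℂ⟦X⟧) :
    hasse r i (X ^ a * F) = X ^ a * hasse (r - a) i F := by
  ext n
  rw [coeff_hasse, coeff_X_pow_mul', coeff_X_pow_mul']
  split_ifs with h
  · rw [coeff_hasse]
    push_cast [h]
    ring_nf
  · simp

theorem hasse_X_pow (r : ℤ) (i a : ℕ) :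
    hasse r i (X ^ a) = ((Ring.choose ((a : ℤ) - r) i : ℤ) : ℂ) • X ^ a := by
  ext n
  rw [coeff_hasse, map_smul, coeff_X_pow, smul_eq_mul]
  split_ifs with h
  · rw [h]
  · simp

/-- The difference of the two sides of the Jacobi identity, integrated against formal series and
truncated. -/
def jacobiDefect (x y : V.space) (w : M.space) (s : ℂ) (l r r' : ℤ) (I : ℕ) :
    ℂ⟦X⟧ →ₗ[ℂ] ℂ⟦X⟧ →ₗ[ℂ] M.space :=
  LinearMap.mk₂ ℂ
    (fun F G => ∑ i ∈ Finset.range I,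
      (((-1 : ℤ) ^ i * Ring.choose l i) •
        (M.residue (r - l + i) F x (M.residue (r' - i) G y w) -
          s • M.residue (r' - l + i) G y (M.residue (r - i) F x w)) -
      M.residue (r + r' + i) (hasse r i F * G) (V.Y (l + i) x y) w))
    (fun F F' G => by
      rw [← Finset.sum_add_distrib]
      refine Finset.sum_congr rfl fun i _ => ?_
      simp only [map_add, LinearMap.add_apply, add_mul, smul_add, smul_sub]
      abel)
    (fun c F G => by
      rw [Finset.smul_sum]
      refine Finset.sum_congr rfl fun i _ => ?_
      simp only [map_smul, LinearMap.smul_apply, smul_mul_assoc, smul_sub, smul_comm _ c])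
    (fun F G G' => by
      rw [← Finset.sum_add_distrib]
      refine Finset.sum_congr rfl fun i _ => ?_
      simp only [map_add, LinearMap.add_apply, mul_add, smul_add, smul_sub]
      abel)
    (fun c F G => by
      rw [Finset.smul_sum]
      refine Finset.sum_congr rfl fun i _ => ?_
      simp only [map_smul, LinearMap.smul_apply, mul_smul_comm, smul_sub, smul_comm _ c])

theorem jacobiDefect_apply (x y : V.space) (w : M.space) (s : ℂ) (l r r' : ℤ) (I : ℕ)
    (F G : ℂ⟦X⟧) : M.jacobiDefect x y w s l r r' I F G = ∑ i ∈ Finset.range I,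
      (((-1 : ℤ) ^ i * Ring.choose l i) •
        (M.residue (r - l + i) F x (M.residue (r' - i) G y w) -
          s • M.residue (r' - l + i) G y (M.residue (r - i) F x w)) -
      M.residue (r + r' + i) (hasse r i F * G) (V.Y (l + i) x y) w) := rfl

theorem jacobiDefect_continuous_left (x y : V.space) (w : M.space) (s : ℂ) (l r r' : ℤ) (I : ℕ)
    (G : ℂ⟦X⟧) : ∀ᶠ a : ℕ in atTop, ∀ F,
      M.jacobiDefect x y w s l r r' I (X ^ a * F) G = 0 := by
  have h1 := (eventually_all_finset (Finset.range I)).2 fun i _ =>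
    M.eventually_residue_X_pow_mul (r - l + i) x (M.residue (r' - i) G y w)
  have h2 := (eventually_all_finset (Finset.range I)).2 fun i _ =>
    M.eventually_residue_X_pow_mul (r - i) x w
  have h3 := (eventually_all_finset (Finset.range I)).2 fun i _ =>
    M.eventually_residue_X_pow_mul (r + r' + i) (V.Y (l + i) x y) w
  filter_upwards [h1, h2, h3] with a h1 h2 h3 F
  rw [jacobiDefect_apply]
  refine Finset.sum_eq_zero fun i hi => ?_
  rw [h1 i hi, h2 i hi, hasse_X_pow_mul, mul_assoc, h3 i hi]
  simp

theorem jacobiDefect_continuous_right (x y : V.space) (w : M.space) (s : ℂ) (l r r' : ℤ) (I : ℕ)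
    (F : ℂ⟦X⟧) : ∀ᶠ a : ℕ in atTop, ∀ G,
      M.jacobiDefect x y w s l r r' I F (X ^ a * G) = 0 := by
  have h1 := (eventually_all_finset (Finset.range I)).2 fun i _ =>
    M.eventually_residue_X_pow_mul (r' - i) y w
  have h2 := (eventually_all_finset (Finset.range I)).2 fun i _ =>
    M.eventually_residue_X_pow_mul (r' - l + i) y (M.residue (r - i) F x w)
  have h3 := (eventually_all_finset (Finset.range I)).2 fun i _ =>
    M.eventually_residue_X_pow_mul (r + r' + i) (V.Y (l + i) x y) w
  filter_upwards [h1, h2, h3] with a h1 h2 h3 G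
  rw [jacobiDefect_apply]
  refine Finset.sum_eq_zero fun i hi => ?_
  rw [h1 i hi, h2 i hi, mul_left_comm, h3 i hi]
  simp

/-- The Jacobi identity for the residue of `(z₁ - z₂)^l z₁^(-r) F(z₁) z₂^(-r') G(z₂)`. -/
theorem jacobi_residue {p q : ℤ} {x y : V.space} (hx : x ∈ V.space.deg p)
    (hy : y ∈ V.space.deg q) (w : M.space) (l r r' : ℤ) :
    ∀ᶠ I : ℕ in atTop, ∀ F G : ℂ⟦X⟧,
      ∑ i ∈ Finset.range I, ((-1 : ℤ) ^ i * Ring.choose l i) •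
        (M.residue (r - l + i) F x (M.residue (r' - i) G y w) -
          ((-1 : ℂ) ^ l * (-1 : ℂ) ^ (p * q)) •
            M.residue (r' - l + i) G y (M.residue (r - i) F x w)) =
      ∑ i ∈ Finset.range I,
        M.residue (r + r' + i) (hasse r i F * G) (V.Y (l + i) x y) w := by
  -- The cutoff I is forced by truncation of y on w, of x on w and of Y(x,z)y. None of these
  -- involves F or G, so one I serves for all series.
  have h1 := (tendsto_natCast_sub r').eventually (M.eventually_residue_eq_zero y w)
  have h2 := (tendsto_natCast_sub r).eventually (M.eventually_residue_eq_zero x w)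
  have h3 := (tendsto_natCast_sub (-l)).eventually (V.adjoint.eventually_Y_eq_zero x y)
  filter_upwards [eventually_forall_ge_atTop.2 h1, eventually_forall_ge_atTop.2 h2,
    eventually_forall_ge_atTop.2 h3] with I h1 h2 h3 F G
  set s : ℂ := (-1 : ℂ) ^ l * (-1 : ℂ) ^ (p * q) with hs
  rw [← sub_eq_zero, ← Finset.sum_sub_distrib, ← jacobiDefect_apply]
  have key : ∀ a b : ℕ, M.jacobiDefect x y w s l r r' I (X ^ a) (X ^ b) = 0 := by
    intro a b
    have h := M.action.jacobi p q x y w hx hy l (a - r) (b - r')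
    rw [← hs, finsum_eq_sum_of_support_subset (s := Finset.range I),
      finsum_eq_sum_of_support_subset (s := Finset.range I)] at h
    · rw [jacobiDefect_apply, Finset.sum_sub_distrib, sub_eq_zero]
      refine Eq.trans ?_ (h.trans ?_)
      · refine Finset.sum_congr rfl fun i _ => ?_
        simp only [residue_X_pow]
        rw [show (a : ℤ) - r + l - i = a - (r - l + i) by ring,
          show (b : ℤ) - r' + i = b - (r' - i) by ring,
          show (b : ℤ) - r' + l - i = b - (r' - l + i) by ring,
          show (a : ℤ) - r + i = a - (r - i) by ring]
      · refine Finset.sum_congr rfl fun i _ => ?_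
        rw [hasse_X_pow, smul_mul_assoc, ← pow_add, map_smul, LinearMap.smul_apply,
          LinearMap.smul_apply, residue_X_pow, Int.cast_smul_eq_zsmul]
        congr 4
        push_cast
        ring
    · intro i hi
      by_contra h
      refine hi ?_
      have h' := h3 i (by simpa using h)
      rw [sub_neg_eq_add, add_comm] at h'
      change V.Y _ x y = 0 at h'
      simp [h']
    · intro i hi
      by_contra h
      refine hi ?_
      have hi' : I ≤ i := by simpa using h
      have e1 := h1 i hi' (X ^ b)
      have e2 := h2 i hi' (X ^ a)
      rw [residue_X_pow, show (b : ℤ) - -((i : ℤ) - r') = b - r' + i by ring] at e1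
      rw [residue_X_pow, show (a : ℤ) - -((i : ℤ) - r) = a - r + i by ring] at e2
      simp [e1, e2]
  have key' : ∀ b : ℕ, ∀ F, M.jacobiDefect x y w s l r r' I F (X ^ b) = 0 := fun b F =>
    LinearMap.congr_fun (eq_zero_of_X_pow ((M.jacobiDefect x y w s l r r' I).flip (X ^ b))
      (M.jacobiDefect_continuous_left x y w s l r r' I (X ^ b)) fun a => key a b) F
  exact LinearMap.congr_fun (eq_zero_of_X_pow _
    (M.jacobiDefect_continuous_right x y w s l r r' I F) fun b => key' b F) G

/-! ### Residues which lie in `O(M)` -/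

/-- The i-th Hasse derivative of (1+z)^s is (s choose i)(1+z)^(s-i); on coefficients this is the
trinomial revision identity for binomial coefficients. -/
theorem hasse_zero_binomialSeries (s : ℂ) (i : ℕ) :
    hasse 0 i (PowerSeries.binomialSeries ℂ s) =
      Ring.choose s i • (X ^ i * PowerSeries.binomialSeries ℂ (s - i)) := by
  ext n
  rw [coeff_hasse, map_smul, coeff_X_pow_mul', sub_zero, Ring.choose_natCast]
  split_ifs with h
  · have := Ring.choose_smul_choose s h
    rw [nsmul_eq_mul] at this
    simpa using this
  · rw [Nat.choose_eq_zero_of_lt (by omega)]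
    simp

/-- The Leibniz rule for the product z^(-r) F(z), which on coefficients is Vandermonde's identity
for n + (-r). -/
theorem hasse_eq_sum (r : ℤ) (i : ℕ) (F : ℂ⟦X⟧) :
    hasse r i F = ∑ ab ∈ Finset.HasAntidiagonal.antidiagonal i,
      ((Ring.choose (-r) ab.2 : ℤ) : ℂ) • hasse 0 ab.1 F := by
  ext n
  rw [coeff_hasse, map_sum, sub_eq_add_neg, Ring.add_choose_eq i (Commute.all _ _), Int.cast_sum,
    Finset.sum_mul]
  refine Finset.sum_congr rfl fun ab _ => ?_
  rw [map_smul, coeff_hasse, sub_zero, smul_eq_mul]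
  push_cast
  ring

theorem hasse_one (r : ℤ) (F : ℂ⟦X⟧) : hasse r 1 F = hasse 0 1 F - (r : ℂ) • F := by
  ext n
  rw [coeff_hasse, map_sub, coeff_hasse, map_smul, Ring.choose_one_right, Ring.choose_one_right]
  push_cast
  rw [smul_eq_mul]
  ring

/-- Integration by parts. -/
theorem residue_translation (r : ℤ) (F : ℂ⟦X⟧) (x : V.space) (m : M.space) :
    M.residue r F (V.Y 0 V.ω x) m = -M.residue (r + 1) (hasse r 1 F) x m := by
  rw [residue_apply, residue_apply, ← finsum_neg_distrib]
  refine finsum_congr fun n => ?_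
  rw [Y_translation, coeff_hasse, Ring.choose_one_right,
    show (n : ℤ) - (r + 1) = n - r - 1 by ring]
  module

theorem binomialSeries_add_one (s : ℂ) :
    PowerSeries.binomialSeries ℂ (s + 1) =
      PowerSeries.binomialSeries ℂ s + X ^ 1 * PowerSeries.binomialSeries ℂ s := by
  have := binomialSeries_nat (R := ℂ) (A := ℂ) 1
  rw [Nat.cast_one] at this
  rw [binomialSeries_add, this]
  ring

theorem residue_binomialSeries_add_one (r : ℤ) (s : ℂ) (x : V.space) (m : M.space) :
    M.residue r (PowerSeries.binomialSeries ℂ (s + 1)) x m =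
      M.residue r (PowerSeries.binomialSeries ℂ s) x m +
        M.residue (r - 1) (PowerSeries.binomialSeries ℂ s) x m := by
  rw [binomialSeries_add_one, map_add, LinearMap.add_apply, LinearMap.add_apply,
    residue_X_pow_mul, Nat.cast_one]

/-- Zhu's lemma. For j = 0, raise n by applying the previous case to L(-1)x, of weight one higher,
and integrating by parts. To raise j, write (1+z)^(s+1) = (1+z)^s + z(1+z)^s: the second term lowers
the order of the pole by one, which is why j ≤ n is needed. -/
theorem residue_mem_O_of_le (j : ℕ) : ∀ (n : ℕ) {k : ℤ} {x : V.space}, j ≤ n → x ∈ V.wt k →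
    ∀ m : M.space, M.residue (2 + n) (PowerSeries.binomialSeries ℂ ((k : ℂ) / 2 + j)) x m ∈ M.O := by
  induction j with
  | zero =>
    intro n
    induction n with
    | zero =>
      intro k x _ hx m
      refine Submodule.subset_span ⟨k, x, m, hx, ?_⟩
      rw [circ, res_eq_residue]
      simp
    | succ n ih =>
      intro k x _ hx m
      have h0 := ih (Nat.zero_le n) hx m
      have h1 := ih (Nat.zero_le n) (translation_mem_wt hx) m
      rw [residue_translation, hasse_one, hasse_zero_binomialSeries, Ring.choose_one_right,
        show (((k + 2 : ℤ) : ℂ) / 2 + (0 : ℕ)) = (k : ℂ) / 2 + 1 by push_cast; ring,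
        map_sub, LinearMap.sub_apply, LinearMap.sub_apply, map_smul, map_smul,
        LinearMap.smul_apply, LinearMap.smul_apply, LinearMap.smul_apply, LinearMap.smul_apply,
        residue_X_pow_mul, residue_binomialSeries_add_one,
        show ((k : ℂ) / 2 + 1 - (1 : ℕ)) = (k : ℂ) / 2 by push_cast; ring,
        show (2 : ℤ) + n + 1 - (1 : ℕ) = 2 + n by push_cast; ring,
        add_sub_cancel_right] at h1
      rw [Nat.cast_zero, add_zero] at h0 ⊢
      rw [show (2 : ℤ) + (n + 1 : ℕ) = 2 + n + 1 by push_cast; ring]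
      -- Integration by parts gives (2+n) times the residue of order 3+n plus a multiple of the
      -- residue of order 2+n, so one divides by 2+n.
      have hne : ((2 + n : ℤ) : ℂ) ≠ 0 := by
        exact_mod_cast (by omega : (2 + n : ℤ) ≠ 0)
      rw [← Submodule.smul_mem_iff _ hne]
      convert add_mem h1 (Submodule.smul_mem _ ((k : ℂ) / 2 + 1 - (2 + n : ℤ)) h0) using 1
      module
  | succ j ih =>
    intro n k x hj hx m
    rw [Nat.cast_add, Nat.cast_one, ← add_assoc, residue_binomialSeries_add_one]
    refine add_mem (ih n (by omega) hx m) ?_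
    have := ih (n - 1) (by omega) hx m
    rwa [show (2 : ℤ) + (n - 1 : ℕ) = 2 + n - 1 by omega] at this

theorem residue_mem_O {k : ℤ} {x : V.space} (hx : x ∈ V.wt k) (m : M.space) (r : ℤ) (s : ℂ)
    (j n : ℕ) (h : j ≤ n) (hr : r = 2 + n) (hs : s = (k : ℂ) / 2 + j) :
    M.residue r (PowerSeries.binomialSeries ℂ s) x m ∈ M.O := by
  rw [hr, hs]
  exact M.residue_mem_O_of_le j n h hx m

/-- The supercommutator of two residues lies in `O(M)`. -/
theorem residue_commutator_mem_O {p q k l : ℤ} {x y : V.space} (hx : x ∈ V.space.deg p)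
    (hxk : x ∈ V.wt k) (hy : y ∈ V.space.deg q) (hyl : y ∈ V.wt l) (m : M.space)
    (e e' δ : ℕ) (h1 : 1 ≤ e + e') (h2 : e + e' ≤ 1 + δ) :
    M.residue 1 (PowerSeries.binomialSeries ℂ ((k : ℂ) / 2 - 1 + e)) x
        (M.residue (1 + δ) (PowerSeries.binomialSeries ℂ ((l : ℂ) / 2 - 1 + e')) y m) -
      (-1 : ℂ) ^ (p * q) • M.residue (1 + δ) (PowerSeries.binomialSeries ℂ ((l : ℂ) / 2 - 1 + e')) y
        (M.residue 1 (PowerSeries.binomialSeries ℂ ((k : ℂ) / 2 - 1 + e)) x m) ∈ M.O := by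
  obtain ⟨I, h, hI⟩ := ((M.jacobi_residue hx hy m 0 1 (1 + δ)).and (eventually_ge_atTop 1)).exists
  have h := h (PowerSeries.binomialSeries ℂ ((k : ℂ) / 2 - 1 + e)) (PowerSeries.binomialSeries ℂ ((l : ℂ) / 2 - 1 + e'))
  rw [Finset.sum_eq_single_of_mem 0 (Finset.mem_range.2 hI) fun i _ hi => by
    rw [Ring.choose_zero_pos _ (Nat.pos_of_ne_zero hi)]; simp] at h
  simp only [pow_zero, Ring.choose_zero_right, mul_one, one_smul, zpow_zero, one_mul, sub_zero,
    Nat.cast_zero, add_zero, zero_add] at h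
  rw [h]
  refine Submodule.sum_mem _ fun i _ => ?_
  rw [hasse_eq_sum, Finset.sum_mul, map_sum, LinearMap.sum_apply, LinearMap.sum_apply]
  refine Submodule.sum_mem _ fun ab hab => ?_
  have hab := Finset.HasAntidiagonal.mem_antidiagonal.1 hab
  rw [hasse_zero_binomialSeries, smul_mul_assoc, smul_mul_assoc, mul_assoc, ← binomialSeries_add]
  simp only [map_smul, LinearMap.smul_apply]
  refine Submodule.smul_mem _ _ (Submodule.smul_mem _ _ ?_)
  rw [residue_X_pow_mul]
  -- With i = a + b, the residue has order 2 + δ + b, and its exponent exceeds the weight of x_i y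
  -- by b + e + e' - 1. Zhu's lemma thus requires 0 ≤ b + e + e' - 1 ≤ δ + b, which the two bounds
  -- on e + e' guarantee.
  refine M.residue_mem_O (mode_mem_wt _ hxk hyl) m _ _ (ab.2 + (e + e' - 1)) (δ + ab.2) (by omega)
    (by rw [← hab]; push_cast; ring) ?_
  rw [← hab, Nat.cast_add ab.2, Nat.cast_sub h1]
  push_cast
  ring

/-! ### The bilinear operations underlying `∗_l` and `∗_r` -/

/-- For `e = 1` this is the operation `u ∗_l m`, for `e = 0` it is `m ∗_r u` without its sign. -/
def zhu (e : ℕ) : V.space →ₗ[ℂ] M.space →ₗ[ℂ] M.space :=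
  V.semisimple.glue fun k =>
    M.residue 1 (PowerSeries.binomialSeries ℂ ((k : ℂ) / 2 - 1 + e)) ∘ₗ
      (Module.End.eigenspace (V.Y 1 V.ω) ((k : ℂ) / 2)).subtype

theorem zhu_apply (e : ℕ) {k : ℤ} {x : V.space} (hx : x ∈ V.wt k) (m : M.space) :
    M.zhu e x m = M.residue 1 (PowerSeries.binomialSeries ℂ ((k : ℂ) / 2 - 1 + e)) x m := by
  rw [zhu, V.semisimple.glue_apply _ hx]
  rfl

theorem wt_deg_induction {motive : V.space → Prop} (x : V.space)
    (mem : ∀ p k, ∀ y ∈ V.space.deg p, y ∈ V.wt k → motive y) (zero : motive 0)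
    (add : ∀ y z, motive y → motive z → motive (y + z)) : motive x :=
  V.semisimple.induction x (fun k _ hy => wt_induction hy (fun p => mem p k) zero add) zero add

theorem O_induction {motive : M.space → Prop} {x : M.space} (hx : x ∈ M.O)
    (mem : ∀ p k, ∀ y ∈ V.space.deg p, y ∈ V.wt k → ∀ m,
      motive (M.residue 2 (PowerSeries.binomialSeries ℂ ((k : ℂ) / 2)) y m))
    (zero : motive 0) (add : ∀ y z, motive y → motive z → motive (y + z))
    (smul : ∀ (c : ℂ) y, motive y → motive (c • y)) : motive x := by
  induction hx using Submodule.span_induction with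
  | zero => exact zero
  | add x y _ _ hx hy => exact add _ _ hx hy
  | smul c x _ hx => exact smul _ _ hx
  | mem x hx =>
    obtain ⟨k, y, m, hy, rfl⟩ := hx
    rw [circ, res_eq_residue]
    refine wt_induction (motive := fun y =>
      motive (M.residue 2 (PowerSeries.binomialSeries ℂ ((k : ℂ) / 2)) y m)) hy
      (fun p y hp hk => mem p k y hp hk m) (by simpa using zero) fun y z hy hz => ?_
    simpa using add _ _ hy hz

/-- Modulo O(M) the operation can be moved past y ∘ -, up to sign, and what results is again of the
form y ∘ m'. -/
theorem zhu_mem_O (e : ℕ) (he : e ≤ 1) (x : V.space) {m : M.space} (hm : m ∈ M.O) :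
    M.zhu e x m ∈ M.O := by
  refine wt_deg_induction (motive := fun x => M.zhu e x m ∈ M.O) x ?_ (by simp)
    fun y z hy hz => by simpa using add_mem hy hz
  intro p k x hx hxk
  refine M.O_induction (motive := fun m => M.zhu e x m ∈ M.O) hm ?_ (by simp)
    (fun y z hy hz => by simpa using add_mem hy hz)
    (fun c y hy => by simpa using Submodule.smul_mem _ _ hy)
  intro q l y hy hyl m
  -- The values e' = 1 and δ = 1 make the residue in y equal to y ∘ m; the bound e + e' ≤ 1 + δ is
  -- where e ≤ 1 is used.
  have h := M.residue_commutator_mem_O hx hxk hy hyl m e 1 1 (by omega) (by omega)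
  rw [Nat.cast_one, Nat.cast_one, sub_add_cancel, show (1 : ℤ) + 1 = 2 by norm_num] at h
  rw [M.zhu_apply e hxk]
  refine (Submodule.sub_mem_iff_left _ (Submodule.smul_mem _ _ ?_)).1 h
  exact M.residue_mem_O hyl _ _ _ 0 0 le_rfl (by simp) (by simp)

theorem residue_eq_sum (r : ℤ) (F : ℂ⟦X⟧) (x : V.space) (m : M.space) (I : ℕ)
    (hI : ∀ i : ℕ, I ≤ i → M.Y (i - r) x m = 0) :
    M.residue r F x m = ∑ i ∈ Finset.range I, coeff i F • M.Y (i - r) x m := by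
  rw [residue_apply, finsum_eq_sum_of_support_subset]
  intro i hi
  by_contra h
  refine hi ?_
  simp only [hI i (by simpa using h), smul_zero]

variable (V) in
/-- The residues for the adjoint module, as operations on `V`. -/
def selfResidue (r : ℤ) : ℂ⟦X⟧ →ₗ[ℂ] V.space →ₗ[ℂ] V.space →ₗ[ℂ] V.space :=
  V.adjoint.residue r

theorem selfResidue_eq_sum (r : ℤ) (F : ℂ⟦X⟧) (x y : V.space) (I : ℕ)
    (hI : ∀ i : ℕ, I ≤ i → V.Y (i - r) x y = 0) :
    selfResidue V r F x y = ∑ i ∈ Finset.range I, coeff i F • V.Y (i - r) x y :=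
  V.adjoint.residue_eq_sum r F x y I hI

variable (V) in
/-- `O(V)`, as a subspace of `V`. -/
def selfO : Submodule ℂ V.space := V.adjoint.O

theorem selfO_induction {motive : V.space → Prop} {x : V.space} (hx : x ∈ selfO V)
    (mem : ∀ p k, ∀ y ∈ V.space.deg p, y ∈ V.wt k → ∀ m,
      motive (selfResidue V 2 (PowerSeries.binomialSeries ℂ ((k : ℂ) / 2)) y m))
    (zero : motive 0) (add : ∀ y z, motive y → motive z → motive (y + z))
    (smul : ∀ (c : ℂ) y, motive y → motive (c • y)) : motive x :=
  V.adjoint.O_induction (motive := motive) hx mem zero add smul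

/-- The residue of Y(x ∘ y, z) expands, by the Jacobi identity with l = -2, into outer residues in x
of order at least 2 and outer residues in y of order at least 3. Zhu's lemma applies to each of
them. -/
theorem zhu_mem_O_of_mem (e : ℕ) (he : e ≤ 1) {x : V.space} (hx : x ∈ selfO V) (m : M.space) :
    M.zhu e x m ∈ M.O := by
  refine selfO_induction (motive := fun x => M.zhu e x m ∈ M.O) hx ?_ (by simp)
    (fun y z hy hz => by simpa using add_mem hy hz)
    (fun c y hy => by simpa using Submodule.smul_mem _ _ hy)
  intro p k x hx hxk y
  refine wt_deg_induction (motive := fun y : V.space => M.zhu e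
    (selfResidue V 2 (PowerSeries.binomialSeries ℂ ((k : ℂ) / 2)) x y) m ∈ M.O) y ?_ (by simp)
    (fun y z hy hz => by simpa using add_mem hy hz)
  intro q l y hy hyl
  have hbd : ∀ᶠ I : ℕ in atTop, ∀ i : ℕ, I ≤ i → V.Y (i - 2) x y = 0 :=
    eventually_forall_ge_atTop.2
      ((tendsto_natCast_sub 2).eventually (V.adjoint.eventually_Y_eq_zero x y))
  obtain ⟨I, h, hI⟩ := ((M.jacobi_residue hx hy m (-2) 0 1).and hbd).exists
  have h := h (PowerSeries.binomialSeries ℂ ((k : ℂ) / 2))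
    (PowerSeries.binomialSeries ℂ ((l : ℂ) / 2 + e))
  -- Each x_{i-2}y has its own weight, and the exponent attached to it by `zhu` is exactly the one
  -- produced by the i-th Hasse derivative of (1+z)^(k/2).
  have e2 : M.zhu e (selfResidue V 2 (PowerSeries.binomialSeries ℂ ((k : ℂ) / 2)) x y) m =
      ∑ i ∈ Finset.range I, M.residue (0 + 1 + i)
        (hasse 0 i (PowerSeries.binomialSeries ℂ ((k : ℂ) / 2)) *
          PowerSeries.binomialSeries ℂ ((l : ℂ) / 2 + e)) (V.Y (-2 + i) x y) m := by
    rw [selfResidue_eq_sum _ _ _ _ I hI, map_sum, LinearMap.sum_apply]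
    refine Finset.sum_congr rfl fun i _ => ?_
    rw [map_smul, LinearMap.smul_apply, M.zhu_apply e (mode_mem_wt _ hxk hyl),
      hasse_zero_binomialSeries, smul_mul_assoc, mul_assoc, ← binomialSeries_add, map_smul,
      LinearMap.smul_apply, LinearMap.smul_apply, residue_X_pow_mul, binomialSeries_coeff,
      smul_eq_mul, mul_one, add_sub_cancel_right, zero_add, neg_add_eq_sub,
      show ((k + l - 2 * ((i : ℤ) - 2) - 2 : ℤ) : ℂ) / 2 - 1 + e = k / 2 - i + (l / 2 + e) by
        push_cast; ring]
  rw [e2, ← h]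
  refine Submodule.sum_mem _ fun i _ => ?_
  rw [← Int.cast_smul_eq_zsmul ℂ]
  refine Submodule.smul_mem _ _ (sub_mem ?_ (Submodule.smul_mem _ _ ?_))
  · exact M.residue_mem_O hxk _ _ _ 0 i (Nat.zero_le _) (by ring) (by simp)
  · exact M.residue_mem_O hyl _ _ _ e (i + 1) (by omega) (by push_cast; ring) rfl

theorem deg_induction {motive : V.space → Prop} {p : ℤ} {x : V.space} (hx : x ∈ V.space.deg p)
    (mem : ∀ k, ∀ y ∈ V.space.deg p, y ∈ V.wt k → motive y) (zero : motive 0)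
    (add : ∀ y z, motive y → motive z → motive (y + z)) : motive x := by
  -- Weight components of x need not visibly have degree p; projecting a decomposition into vectors
  -- homogeneous for both gradings onto degree p repairs this.
  let π : V.space →ₗ[ℂ] V.space :=
    V.space.isInternal.glue fun i =>
      if i = p then (V.space.deg i).subtype else 0
  have hπ : π x = x := by simp [π, V.space.isInternal.glue_apply _ hx]
  rw [← hπ]
  refine wt_deg_induction (motive := fun x => motive (π x)) x ?_ (by simpa using zero)
    fun y z hy hz => by simpa using add _ _ hy hz
  intro q k y hy hyk
  rcases eq_or_ne q p with rfl | h
  · simpa [π, V.space.isInternal.glue_apply _ hy] using mem k y hy hyk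
  · simpa [π, V.space.isInternal.glue_apply _ hy, h] using zero

/-- The left and the right action supercommute up to `O(M)`. -/
theorem zhu_commutator_mem_O {p q : ℤ} {x y : V.space} (hx : x ∈ V.space.deg p)
    (hy : y ∈ V.space.deg q) (m : M.space) :
    M.zhu 1 x (M.zhu 0 y m) - (-1 : ℂ) ^ (p * q) • M.zhu 0 y (M.zhu 1 x m) ∈ M.O := by
  refine deg_induction (motive := fun x =>
    M.zhu 1 x (M.zhu 0 y m) - (-1 : ℂ) ^ (p * q) • M.zhu 0 y (M.zhu 1 x m) ∈ M.O) hx ?_ (by simp)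
    fun x x' h h' => by
      simpa only [map_add, LinearMap.add_apply, smul_add, add_sub_add_comm] using add_mem h h'
  intro k x hx hxk
  refine deg_induction (motive := fun y =>
    M.zhu 1 x (M.zhu 0 y m) - (-1 : ℂ) ^ (p * q) • M.zhu 0 y (M.zhu 1 x m) ∈ M.O) hy ?_ (by simp)
    fun y y' h h' => by
      simpa only [map_add, LinearMap.add_apply, smul_add, add_sub_add_comm] using add_mem h h'
  intro l y hy hyl
  rw [M.zhu_apply 1 hxk, M.zhu_apply 0 hyl, M.zhu_apply 1 hxk, M.zhu_apply 0 hyl]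
  have h := M.residue_commutator_mem_O hx hxk hy hyl m 1 0 0 (by omega) (by omega)
  rwa [show (1 : ℤ) + (0 : ℕ) = 1 by simp] at h

end DGVOA.WeakModule

/-! ### Bilinear maps on associated graded spaces -/

namespace AssocGraded

variable {A : Type u} {B C : Type v} [AddCommGroup A] [Module ℂ A] [AddCommGroup B] [Module ℂ B]
  [AddCommGroup C] [Module ℂ C] (F : ℤ → Submodule ℂ A) (G : ℤ → Submodule ℂ B)
  (H : ℤ → Submodule ℂ C)

/-- The bilinear map on associated graded spaces induced by a bilinear map which shifts the
filtrations by at most `r`. -/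
def map₂ (r : ℤ) (f : A →ₗ[ℂ] B →ₗ[ℂ] C)
    -- The index is q + (p + r) because fixing a in F^p gives a linear map which shifts the
    -- filtration by p + r.
    (hf : ∀ p q a b, a ∈ F p → b ∈ G q → f a b ∈ H (q + (p + r))) :
    Total F →ₗ[ℂ] Total G →ₗ[ℂ] Total H :=
  lift F fun p => Piece.lift F p
    { toFun := fun a => map G H (p + r) (f a) fun q b hb => hf p q a b a.2 hb
      map_add' := fun a a' => ext_symb G fun q b hb => by
        rw [LinearMap.add_apply, map_symb, map_symb, map_symb, ← map_add]
        exact symb_congr H rfl (by simp) _ _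
      map_smul' := fun c a => ext_symb G fun q b hb => by
        rw [LinearMap.smul_apply, map_symb, map_symb, ← map_smul]
        exact symb_congr H rfl (by simp) _ _ }
    fun a ha ha' => ext_symb G fun q b hb => by
      refine (map_symb G H (p + r) (f a) _ q b hb).trans (symb_eq_zero H _ ?_)
      have := hf (p - 1) q a b ha' hb
      rwa [show q + (p - 1 + r) = q + (p + r) - 1 by ring] at this

theorem map₂_symb (r : ℤ) (f : A →ₗ[ℂ] B →ₗ[ℂ] C)
    (hf : ∀ p q a b, a ∈ F p → b ∈ G q → f a b ∈ H (q + (p + r))) (p q : ℤ) (a : A) (b : B)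
    (ha : a ∈ F p) (hb : b ∈ G q) :
    map₂ F G H r f hf (symb F p ⟨a, ha⟩) (symb G q ⟨b, hb⟩) =
      symb H (q + (p + r)) ⟨f a b, hf p q a b ha hb⟩ := by
  rw [map₂, symb, LinearMap.comp_apply, lift_incl, Piece.lift_mk]
  exact map_symb G H (p + r) (f a) _ q b hb

theorem IsSymb.congr {p : ℤ} {a b : A} {x : Total F} (h : IsSymb F p a x)
    (hab : b - a ∈ F (p - 1)) (hle : F (p - 1) ≤ F p) : IsSymb F p b x := by
  obtain ⟨ha, rfl⟩ := h
  have hb : b ∈ F p := by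
    have := add_mem (hle hab) ha
    rwa [sub_add_cancel] at this
  refine ⟨hb, ?_⟩
  rw [← sub_eq_zero, ← map_sub]
  exact symb_eq_zero F _ hab

end AssocGraded

namespace DGVOA.WeakModule

open PowerSeries Filter

variable {V : DGVOA.{u}} (M : WeakModule.{u, v} V)

/-! ### The filtrations of `M` and of `A(M)` -/

/-- The subspace `⨁ q ≤ p, M^[q]` of `M`. -/
def low (p : ℤ) : Submodule ℂ M.space := ⨆ q : {q : ℤ // q ≤ p}, M.space.deg q

theorem mem_low {p q : ℤ} (h : q ≤ p) {m : M.space} (hm : m ∈ M.space.deg q) : m ∈ M.low p :=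
  Submodule.mem_iSup_of_mem (⟨q, h⟩ : {q : ℤ // q ≤ p}) hm

theorem low_mono {p q : ℤ} (h : p ≤ q) : M.low p ≤ M.low q :=
  iSup_le fun r => fun _ hm => M.mem_low (r.2.trans h) hm

theorem cls_mem_F {p : ℤ} {m : M.space} (hm : m ∈ M.low p) : M.cls m ∈ M.F p :=
  ⟨m, hm, rfl⟩

theorem cls_mem_F_of_deg {p : ℤ} {m : M.space} (hm : m ∈ M.space.deg p) : M.cls m ∈ M.F p :=
  M.cls_mem_F (M.mem_low le_rfl hm)

theorem F_mono {p q : ℤ} (h : p ≤ q) : M.F p ≤ M.F q := Submodule.map_mono (M.low_mono h)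

theorem F_induction {p : ℤ} {motive : M.A → Prop} {a : M.A} (ha : a ∈ M.F p)
    (mem : ∀ q ≤ p, ∀ m ∈ M.space.deg q, motive (M.cls m)) (zero : motive 0)
    (add : ∀ a b, motive a → motive b → motive (a + b)) : motive a := by
  obtain ⟨m, hm, rfl⟩ := ha
  refine Submodule.iSup_induction _ (motive := fun m => motive (M.cls m)) hm
    (fun q m hm => mem q q.2 m hm) ?_ fun m m' h h' => ?_
  · rwa [map_zero]
  · rw [map_add]
    exact add _ _ h h'

theorem exists_deg_of_mem_F {p : ℤ} {a : M.A} (ha : a ∈ M.F p) :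
    ∃ m ∈ M.space.deg p, a - M.cls m ∈ M.F (p - 1) := by
  refine M.F_induction (motive := fun a => ∃ m ∈ M.space.deg p, a - M.cls m ∈ M.F (p - 1)) ha
    (fun q hq m hm => ?_) ⟨0, zero_mem _, by simp⟩ ?_
  · rcases hq.eq_or_lt with rfl | hlt
    · exact ⟨m, hm, by simp⟩
    · exact ⟨0, zero_mem _, by simpa using M.cls_mem_F (M.mem_low (by omega) hm)⟩
  · rintro a b ⟨m, hm, h⟩ ⟨m', hm', h'⟩
    refine ⟨m + m', add_mem hm hm', ?_⟩
    rw [map_add, add_sub_add_comm]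
    exact add_mem h h'

/-- The leading mode x_{-r}m has degree p + q + 2r - 2, and each further mode lies two degrees
lower. -/
theorem residue_mem_low {p q : ℤ} {x : V.space} {m : M.space} (hx : x ∈ V.space.deg p)
    (hm : m ∈ M.space.deg q) (r t : ℤ) (F : ℂ⟦X⟧) (ht : p + q + 2 * r - 2 ≤ t) :
    M.residue r F x m ∈ M.low t := by
  obtain ⟨I, hI⟩ := (eventually_forall_ge_atTop.2
    ((tendsto_natCast_sub r).eventually (M.eventually_Y_eq_zero x m))).exists
  rw [M.residue_eq_sum r F x m I hI]
  exact Submodule.sum_mem _ fun i _ => Submodule.smul_mem _ _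
    (M.mem_low (by omega) (M.action.mode_mem _ p q x m hx hm))

theorem exists_binomialSeries (s : ℂ) :
    ∃ G : ℂ⟦X⟧, PowerSeries.binomialSeries ℂ s = X ^ 0 + X ^ 1 * G := by
  refine ⟨PowerSeries.mk fun i => coeff (i + 1) (PowerSeries.binomialSeries ℂ s), ?_⟩
  refine PowerSeries.ext fun n => ?_
  rcases n with _ | n
  · simp
  · rw [map_add, coeff_X_pow_mul, coeff_mk, pow_zero, coeff_one, if_neg (by omega),
      zero_add]

/-- The series has constant term 1, so subtracting the leading mode leaves a residue of order r - 1,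
two degrees lower. -/
theorem residue_binomialSeries_sub_mem_low {p q : ℤ} {x : V.space} {m : M.space}
    (hx : x ∈ V.space.deg p) (hm : m ∈ M.space.deg q) (r t : ℤ) (s : ℂ)
    (ht : p + q + 2 * r - 4 ≤ t) :
    M.residue r (PowerSeries.binomialSeries ℂ s) x m - M.Y (-r) x m ∈ M.low t := by
  obtain ⟨G, hG⟩ := exists_binomialSeries s
  rw [hG, map_add, LinearMap.add_apply, LinearMap.add_apply, residue_X_pow, residue_X_pow_mul,
    Nat.cast_zero, zero_sub, add_sub_cancel_left]
  exact M.residue_mem_low hx hm _ _ _ (by push_cast; omega)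

theorem zhu_sub_mem_low (e : ℕ) {p q : ℤ} {x : V.space} {m : M.space}
    (hx : x ∈ V.space.deg p) (hm : m ∈ M.space.deg q) :
    M.zhu e x m - M.Y (-1) x m ∈ M.low (p + q - 2) := by
  refine deg_induction (motive := fun x => M.zhu e x m - M.Y (-1) x m ∈ M.low (p + q - 2)) hx ?_
    (by simp) fun x x' h h' => by
      simpa only [map_add, LinearMap.add_apply, add_sub_add_comm] using add_mem h h'
  intro k x hx hxk
  rw [M.zhu_apply e hxk]
  exact M.residue_binomialSeries_sub_mem_low hx hm 1 _ _ (by omega)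

/-- Since (1+z)^h - (1+z)^(h-1) = z(1+z)^(h-1), the pole cancels and the leading mode becomes x_0 m.
This is why the bracket has degree -2. -/
theorem zhu_sub_zhu_mem_low {p q : ℤ} {x : V.space} {m : M.space}
    (hx : x ∈ V.space.deg p) (hm : m ∈ M.space.deg q) :
    M.zhu 1 x m - M.zhu 0 x m - M.Y 0 x m ∈ M.low (p + q - 4) := by
  refine deg_induction (motive := fun x =>
    M.zhu 1 x m - M.zhu 0 x m - M.Y 0 x m ∈ M.low (p + q - 4)) hx ?_
    (by simp) fun x x' h h' => by
      simpa only [map_add, LinearMap.add_apply, add_sub_add_comm] using add_mem h h'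
  intro k x hx hxk
  rw [M.zhu_apply 1 hxk, M.zhu_apply 0 hxk, Nat.cast_one, Nat.cast_zero, add_zero,
    residue_binomialSeries_add_one, add_sub_cancel_left]
  exact M.residue_binomialSeries_sub_mem_low hx hm 0 _ _ (by omega)

/-- This mode is the leading term of a residue of order 2 + n that lies in O(M), so its class is
minus that of the lower terms. The filtration index is two below the degree of the mode. -/
theorem cls_Y_mem_F {p q : ℤ} {x : V.space} {m : M.space} (hx : x ∈ V.space.deg p)
    (hm : m ∈ M.space.deg q) (n : ℕ) : M.cls (M.Y (-(2 + n)) x m) ∈ M.F (p + q + 2 * n) := by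
  refine deg_induction (motive := fun x =>
    M.cls (M.Y (-(2 + n)) x m) ∈ M.F (p + q + 2 * n)) hx ?_ (by simp) fun x x' h h' => by
      simpa only [map_add, LinearMap.add_apply] using add_mem h h'
  intro k x hx hxk
  have h := M.residue_mem_O hxk m (2 + n) (k / 2) 0 n (Nat.zero_le _) rfl (by simp)
  have h' := M.cls_mem_F (M.residue_binomialSeries_sub_mem_low hx hm (2 + n) (p + q + 2 * n)
    (k / 2) (by omega))
  have h0 : M.cls (M.residue (2 + n) (PowerSeries.binomialSeries ℂ ((k : ℂ) / 2)) x m) = 0 :=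
    (Submodule.Quotient.mk_eq_zero M.O).2 h
  rw [map_sub, h0, zero_sub] at h'
  exact neg_mem_iff.1 h'

/-! ### The operations on `A(M)` -/

variable (V) in
/-- The quotient map `V → A(V)`. -/
def selfCls : V.space →ₗ[ℂ] V.adjoint.A := V.adjoint.cls

/-- The map `A(V) × A(M) → A(M)` induced by `zhu e`. -/
def zhuA (e : ℕ) (he : e ≤ 1) : V.adjoint.A →ₗ[ℂ] M.A →ₗ[ℂ] M.A :=
  LinearMap.liftQ₂ (selfO V) M.O ((M.zhu e).compr₂ M.cls)
    (fun _ hx => LinearMap.ext fun m =>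
      (Submodule.Quotient.mk_eq_zero M.O).2 (M.zhu_mem_O_of_mem e he hx m))
    (fun _ hm => LinearMap.ext fun x =>
      (Submodule.Quotient.mk_eq_zero M.O).2 (M.zhu_mem_O e he x hm))

theorem zhuA_cls (e : ℕ) (he : e ≤ 1) (x : V.space) (m : M.space) :
    M.zhuA e he (selfCls V x) (M.cls m) = M.cls (M.zhu e x m) := rfl

theorem zhuA_mem_F (e : ℕ) (he : e ≤ 1) (p q : ℤ) (a : V.adjoint.A) (b : M.A)
    (ha : a ∈ V.adjoint.F p) (hb : b ∈ M.F q) : M.zhuA e he a b ∈ M.F (q + (p + 0)) := by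
  refine V.adjoint.F_induction (motive := fun a => M.zhuA e he a b ∈ M.F (q + (p + 0))) ha ?_
    (by simp) fun a a' h h' => by
      simpa only [map_add, LinearMap.add_apply] using add_mem h h'
  intro p' hp (x : V.space) hx
  refine M.F_induction (motive := fun b =>
    M.zhuA e he (selfCls V x) b ∈ M.F (q + (p + 0))) hb ?_
    (by simp) fun a a' h h' => by
      simpa only [map_add, LinearMap.add_apply] using add_mem h h'
  intro q' hq m hm
  rw [zhuA_cls]
  refine M.cls_mem_F ?_
  rw [← sub_add_cancel (M.zhu e x m) (M.Y (-1) x m)]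
  exact add_mem (M.low_mono (by omega) (M.zhu_sub_mem_low e hx hm))
    (M.mem_low (by omega) (M.action.mode_mem _ _ _ _ _ hx hm))

/-- The operation which induces the bracket. -/
def comm : V.adjoint.A →ₗ[ℂ] M.A →ₗ[ℂ] M.A := M.zhuA 1 le_rfl - M.zhuA 0 zero_le_one

theorem comm_cls (x : V.space) (m : M.space) :
    M.comm (selfCls V x) (M.cls m) = M.cls (M.zhu 1 x m - M.zhu 0 x m) := rfl

theorem comm_mem_F (p q : ℤ) (a : V.adjoint.A) (b : M.A)
    (ha : a ∈ V.adjoint.F p) (hb : b ∈ M.F q) : M.comm a b ∈ M.F (q + (p + -2)) := by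
  refine V.adjoint.F_induction (motive := fun a => M.comm a b ∈ M.F (q + (p + -2))) ha ?_
    (by simp) fun a a' h h' => by
      simpa only [map_add, LinearMap.add_apply] using add_mem h h'
  intro p' hp (x : V.space) hx
  refine M.F_induction (motive := fun b =>
    M.comm (selfCls V x) b ∈ M.F (q + (p + -2))) hb ?_
    (by simp) fun a a' h h' => by
      simpa only [map_add, LinearMap.add_apply] using add_mem h h'
  intro q' hq m hm
  rw [comm_cls]
  refine M.cls_mem_F ?_
  rw [← sub_add_cancel (M.zhu 1 x m - M.zhu 0 x m) (M.Y 0 x m)]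
  exact add_mem (M.low_mono (by omega) (M.zhu_sub_zhu_mem_low hx hm))
    (M.mem_low (by omega) (M.action.mode_mem _ _ _ _ _ hx hm))

/-! ### The symbol map -/

/-- The map `M^[p] → gr A(M)` which sends `m` to its class in degree `p`. -/
def degSymb (p : ℤ) : M.space.deg p →ₗ[ℂ] AssocGraded.Total M.F :=
  AssocGraded.symb M.F p ∘ₗ M.cls.restrict fun _ hm => M.cls_mem_F_of_deg hm

/-- The map `M → gr A(M)` which sends `m` of degree `p` to its class in degree `p`. -/
def total : M.space →ₗ[ℂ] M.gr :=
  M.space.isInternal.glue (Y := AssocGraded.Total M.F) M.degSymb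

theorem isSymb_total {p : ℤ} {m : M.space} (hm : m ∈ M.space.deg p) :
    M.IsSymb p (M.cls m) (M.total m) :=
  ⟨M.cls_mem_F_of_deg hm, (M.space.isInternal.glue_apply M.degSymb hm).symm⟩

theorem IsSymb.eq {p : ℤ} {a : M.A} {x y : M.gr} (hx : M.IsSymb p a x) (hy : M.IsSymb p a y) :
    x = y := by
  obtain ⟨_, rfl⟩ := hx
  obtain ⟨_, rfl⟩ := hy
  rfl

theorem IsSymb.congr {p : ℤ} {a b : M.A} {x : M.gr} (h : M.IsSymb p a x)
    (hab : b - a ∈ M.F (p - 1)) : M.IsSymb p b x :=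
  AssocGraded.IsSymb.congr M.F h hab (M.F_mono (by omega))

theorem total_mem_deg {p : ℤ} {m : M.space} (hm : m ∈ M.space.deg p) :
    M.total m ∈ M.gr.deg p := by
  obtain ⟨h, h'⟩ := M.isSymb_total hm
  exact ⟨_, h'⟩

theorem exists_total_eq {p : ℤ} {x : M.gr} (hx : x ∈ M.gr.deg p) :
    ∃ m ∈ M.space.deg p, M.total m = x := by
  obtain ⟨⟨a, ha⟩, rfl⟩ := hx
  obtain ⟨m, hm, h⟩ := M.exists_deg_of_mem_F ha
  exact ⟨m, hm, ((M.isSymb_total hm).congr M h).eq M ⟨ha, rfl⟩⟩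

/-- Identities in gr A(M) can therefore be checked on symbols of elements of M, where action and
bracket are single modes. -/
theorem total_surjective : Function.Surjective M.total := fun x =>
  M.gr.isInternal.induction (motive := fun x => ∃ m, M.total m = x) x
    (fun p y hy => let ⟨m, _, h⟩ := M.exists_total_eq hy; ⟨m, h⟩) ⟨0, map_zero _⟩
    (by rintro _ _ ⟨m, rfl⟩ ⟨m', rfl⟩; exact ⟨m + m', map_add _ _ _⟩)

theorem total_eq_zero {p : ℤ} {m : M.space} (hm : m ∈ M.space.deg p)
    (h : M.cls m ∈ M.F (p - 1)) : M.total m = 0 := by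
  obtain ⟨h1, h2⟩ := M.isSymb_total hm
  exact h2.symm.trans (AssocGraded.symb_eq_zero M.F h1 h)

variable (V) in
/-- The symbol map `V → gr A(V)`. -/
def selfTotal : V.space →ₗ[ℂ] V.adjoint.gr := V.adjoint.total

/-- The action of `gr A(V)` on `gr A(M)`. -/
def grAct : V.adjoint.gr →ₗ[ℂ] M.gr →ₗ[ℂ] M.gr :=
  AssocGraded.map₂ V.adjoint.F M.F M.F 0 (M.zhuA 1 le_rfl) (M.zhuA_mem_F 1 le_rfl)

/-- The bracket of `gr A(V)` on `gr A(M)`. -/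
def grBracket : V.adjoint.gr →ₗ[ℂ] M.gr →ₗ[ℂ] M.gr :=
  AssocGraded.map₂ V.adjoint.F M.F M.F (-2) M.comm M.comm_mem_F

theorem IsSymb.act {p q : ℤ} {a : V.adjoint.A} {b : M.A} {x : V.adjoint.gr} {w : M.gr}
    (ha : V.adjoint.IsSymb p a x) (hb : M.IsSymb q b w) :
    M.IsSymb (p + q) (M.zhuA 1 le_rfl a b) (M.grAct x w) := by
  obtain ⟨ha, rfl⟩ := ha
  obtain ⟨hb, rfl⟩ := hb
  rw [show p + q = q + (p + 0) by ring]
  exact ⟨M.zhuA_mem_F 1 le_rfl _ _ _ _ ha hb, (AssocGraded.map₂_symb _ _ _ _ _ _ _ _ _ _ _ _).symm⟩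

theorem IsSymb.bracket {p q : ℤ} {a : V.adjoint.A} {b : M.A} {x : V.adjoint.gr} {w : M.gr}
    (ha : V.adjoint.IsSymb p a x) (hb : M.IsSymb q b w) :
    M.IsSymb (p + q - 2) (M.comm a b) (M.grBracket x w) := by
  obtain ⟨ha, rfl⟩ := ha
  obtain ⟨hb, rfl⟩ := hb
  rw [show p + q - 2 = q + (p + -2) by ring]
  exact ⟨M.comm_mem_F _ _ _ _ ha hb, (AssocGraded.map₂_symb _ _ _ _ _ _ _ _ _ _ _ _).symm⟩

theorem deg_bilinear_ext {W : Type*} [AddCommGroup W] [Module ℂ W]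
    {f g : V.space →ₗ[ℂ] M.space →ₗ[ℂ] W}
    (h : ∀ p q, ∀ x ∈ V.space.deg p, ∀ m ∈ M.space.deg q, f x m = g x m) (x : V.space)
    (m : M.space) : f x m = g x m :=
  V.space.isInternal.induction (motive := fun x => f x m = g x m) x
    (fun p x hx => M.space.isInternal.induction (motive := fun m => f x m = g x m) m
      (fun q m hm => h p q x hx m hm) (by simp) fun y z hy hz => by rw [map_add, map_add, hy, hz])
    (by simp) fun y z hy hz => by
      rw [map_add, map_add, LinearMap.add_apply, LinearMap.add_apply, hy, hz]

theorem grAct_total (x : V.space) (m : M.space) :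
    M.grAct (selfTotal V x) (M.total m) = M.total (M.Y (-1) x m) := by
  refine M.deg_bilinear_ext (f := M.grAct.compl₁₂ (selfTotal V) M.total)
    (g := (M.Y (-1)).compr₂ M.total) ?_ x m
  intro p q x hx m hm
  have h := IsSymb.act M (V.adjoint.isSymb_total hx) (M.isSymb_total hm)
  have hmem := M.action.mode_mem (-1) p q x m hx hm
  rw [show p + q - 2 * -1 - 2 = p + q by ring] at hmem
  refine IsSymb.eq M h (IsSymb.congr M (M.isSymb_total hmem) ?_)
  change M.cls (M.zhu 1 x m) - M.cls (M.Y (-1) x m) ∈ M.F (_ - 1)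
  rw [← map_sub]
  exact M.cls_mem_F (M.low_mono (by omega) (M.zhu_sub_mem_low 1 hx hm))

theorem grBracket_total (x : V.space) (m : M.space) :
    M.grBracket (selfTotal V x) (M.total m) = M.total (M.Y 0 x m) := by
  refine M.deg_bilinear_ext (f := M.grBracket.compl₁₂ (selfTotal V) M.total)
    (g := (M.Y 0).compr₂ M.total) ?_ x m
  intro p q x hx m hm
  have h := IsSymb.bracket M (V.adjoint.isSymb_total hx) (M.isSymb_total hm)
  have hmem := M.action.mode_mem 0 p q x m hx hm
  rw [show p + q - 2 * 0 - 2 = p + q - 2 by ring] at hmem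
  refine IsSymb.eq M h (IsSymb.congr M (M.isSymb_total hmem) ?_)
  change M.cls (M.zhu 1 x m - M.zhu 0 x m) - M.cls (M.Y 0 x m) ∈ M.F (_ - 1)
  rw [← map_sub]
  exact M.cls_mem_F (M.low_mono (by omega) (M.zhu_sub_zhu_mem_low hx hm))

theorem total_Y_eq_zero {n : ℤ} (hn : n ≤ -2) (x : V.space) (m : M.space) :
    M.total (M.Y n x m) = 0 := by
  refine M.deg_bilinear_ext (f := (M.Y n).compr₂ M.total) (g := 0) ?_ x m
  intro p q x hx m hm
  have h := M.cls_Y_mem_F hx hm (-2 - n).toNat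
  rw [show -(2 + ((-2 - n).toNat : ℤ)) = n by omega] at h
  exact M.total_eq_zero (M.action.mode_mem n p q x m hx hm) (M.F_mono (by omega) h)

theorem total_d (m : M.space) : M.total (M.space.d m) = M.gr.d (M.total m) := by
  refine M.space.isInternal.induction (motive := fun m =>
    M.total (M.space.d m) = M.gr.d (M.total m)) m ?_ (by simp)
    fun y z hy hz => by simp only [map_add, hy, hz]
  intro p m hm
  refine IsSymb.eq M (M.isSymb_total (M.space.d_mem p m hm)) ?_
  obtain ⟨h, h'⟩ := M.isSymb_total hm
  rw [← h']
  exact ⟨M.dA_mem p _ h, (AssocGraded.map_symb M.F M.F 1 M.dA M.dA_mem p _ h).symm⟩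

/-! ### The Poisson identities -/

/-- Taking m = 0 in the Jacobi identity collapses its right side to a single iterated mode, here
passed through the symbol map. -/
theorem total_jacobi {p q : ℤ} {x y : V.space} (hx : x ∈ V.space.deg p)
    (hy : y ∈ V.space.deg q) (w : M.space) (l n : ℤ) :
    M.total (M.Y n (V.Y l x y) w) = ∑ᶠ i : ℕ, ((-1 : ℤ) ^ i * Ring.choose l i) •
      (M.total (M.Y (l - i) x (M.Y (n + i) y w)) -
        ((-1 : ℂ) ^ l * (-1 : ℂ) ^ (p * q)) • M.total (M.Y (n + l - i) y (M.Y i x w))) := by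
  have h := M.action.jacobi p q x y w hx hy l 0 n
  rw [finsum_eq_single (fun i : ℕ => Ring.choose (0 : ℤ) i • _) 0 fun i hi => by
    rw [Ring.choose_zero_pos _ (Nat.pos_of_ne_zero hi), zero_smul]] at h
  simp only [Ring.choose_zero_right, one_smul, Nat.cast_zero, zero_add, sub_zero, add_zero] at h
  rw [← h, ← LinearMap.toAddMonoidHom_coe, AddMonoidHom.map_finsum]
  · simp
  · obtain ⟨N, hN⟩ := M.action.truncation y w
    obtain ⟨N', hN'⟩ := M.action.truncation x w
    refine (Set.finite_lt_nat (max (N - n) N').toNat).subset fun i hi => ?_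
    by_contra hlt
    refine hi ?_
    have hge : (max (N - n) N').toNat ≤ i := not_lt.1 hlt
    simp only [hN (n + i) (by omega), hN' i (by omega), map_zero, smul_zero, sub_zero]

theorem total_jacobi_zero {p q : ℤ} {x y : V.space} (hx : x ∈ V.space.deg p)
    (hy : y ∈ V.space.deg q) (w : M.space) (n : ℤ) :
    M.total (M.Y n (V.Y 0 x y) w) = M.total (M.Y 0 x (M.Y n y w)) -
      (-1 : ℂ) ^ (p * q) • M.total (M.Y n y (M.Y 0 x w)) := by
  rw [M.total_jacobi hx hy, finsum_eq_single _ 0 fun i hi => by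
    rw [Ring.choose_zero_pos _ (Nat.pos_of_ne_zero hi)]; simp]
  simp

/-- For i ≥ 1 the outer modes -1 - i and n - 1 - i are at most -2, the latter because n ≤ 0, so only
i = 0 survives in gr. The case n = -1 yields associativity and n = 0 the Leibniz rule in the first
argument of the bracket. -/
theorem total_jacobi_neg_one {p q : ℤ} {x y : V.space} (hx : x ∈ V.space.deg p)
    (hy : y ∈ V.space.deg q) (w : M.space) {n : ℤ} (hn : n ≤ 0) :
    M.total (M.Y n (V.Y (-1) x y) w) = M.total (M.Y (-1) x (M.Y n y w)) +
      (-1 : ℂ) ^ (p * q) • M.total (M.Y (n - 1) y (M.Y 0 x w)) := by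
  rw [M.total_jacobi hx hy, finsum_eq_single _ 0 fun i hi => by
    rw [M.total_Y_eq_zero (by omega), M.total_Y_eq_zero (by omega)]; simp]
  simp [← sub_eq_add_neg]

theorem total_assoc (x y : V.space) (w : M.space) :
    M.total (M.Y (-1) (V.Y (-1) x y) w) = M.total (M.Y (-1) x (M.Y (-1) y w)) := by
  refine V.space.isInternal.induction (motive := fun x =>
    M.total (M.Y (-1) (V.Y (-1) x y) w) = M.total (M.Y (-1) x (M.Y (-1) y w))) x ?_ (by simp)
    fun x x' h h' => by simp only [map_add, LinearMap.add_apply, h, h']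
  intro p x hx
  refine V.space.isInternal.induction (motive := fun y =>
    M.total (M.Y (-1) (V.Y (-1) x y) w) = M.total (M.Y (-1) x (M.Y (-1) y w))) y ?_ (by simp)
    fun x x' h h' => by simp only [map_add, LinearMap.add_apply, h, h']
  intro q y hy
  rw [M.total_jacobi_neg_one hx hy w (by norm_num), M.total_Y_eq_zero (n := -1 - 1) le_rfl, smul_zero,
    add_zero]

theorem selfTotal_surjective : Function.Surjective (selfTotal V) := V.adjoint.total_surjective

theorem exists_selfTotal_eq {p : ℤ} {x : V.adjoint.gr} (hx : x ∈ V.adjoint.gr.deg p) :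
    ∃ a ∈ V.space.deg p, selfTotal V a = x := V.adjoint.exists_total_eq hx

theorem grAct_selfTotal (a b : V.space) :
    V.adjoint.grAct (selfTotal V a) (selfTotal V b) = selfTotal V (V.Y (-1) a b) :=
  V.adjoint.grAct_total a b

theorem grBracket_selfTotal (a b : V.space) :
    V.adjoint.grBracket (selfTotal V a) (selfTotal V b) = selfTotal V (V.Y 0 a b) :=
  V.adjoint.grBracket_total a b

theorem selfTotal_d (a : V.space) :
    V.adjoint.gr.d (selfTotal V a) = selfTotal V (V.space.d a) := (V.adjoint.total_d a).symm

theorem neg_one_zpow_add_two_mul (p q : ℤ) : (-1 : ℂ) ^ (p + 2 * q) = (-1 : ℂ) ^ p := by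
  rw [zpow_add₀ (by norm_num), zpow_mul]
  norm_num

theorem grAct_mem {p q : ℤ} {x : V.adjoint.gr} {w : M.gr} (hx : x ∈ V.adjoint.gr.deg p)
    (hw : w ∈ M.gr.deg q) : M.grAct x w ∈ M.gr.deg (p + q) := by
  obtain ⟨a, ha, rfl⟩ := exists_selfTotal_eq hx
  obtain ⟨m, hm, rfl⟩ := M.exists_total_eq hw
  rw [grAct_total]
  have := M.total_mem_deg (M.action.mode_mem (-1) p q a m ha hm)
  rwa [show p + q - 2 * -1 - 2 = p + q by ring] at this

theorem grBracket_mem {p q : ℤ} {x : V.adjoint.gr} {w : M.gr} (hx : x ∈ V.adjoint.gr.deg p)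
    (hw : w ∈ M.gr.deg q) : M.grBracket x w ∈ M.gr.deg (p + q + -2) := by
  obtain ⟨a, ha, rfl⟩ := exists_selfTotal_eq hx
  obtain ⟨m, hm, rfl⟩ := M.exists_total_eq hw
  rw [grBracket_total]
  have := M.total_mem_deg (M.action.mode_mem 0 p q a m ha hm)
  rwa [show p + q - 2 * 0 - 2 = p + q + -2 by ring] at this

theorem grAct_grAct (x y : V.adjoint.gr) (w : M.gr) :
    M.grAct (V.adjoint.grAct x y) w = M.grAct x (M.grAct y w) := by
  obtain ⟨a, rfl⟩ := selfTotal_surjective x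
  obtain ⟨b, rfl⟩ := selfTotal_surjective y
  obtain ⟨m, rfl⟩ := M.total_surjective w
  rw [grAct_selfTotal, grAct_total, grAct_total, grAct_total, total_assoc]

theorem grAct_one (w : M.gr) : M.grAct (selfTotal V V.one) w = w := by
  obtain ⟨m, rfl⟩ := M.total_surjective w
  rw [grAct_total, M.action.vacuum, if_pos rfl]

theorem d_grAct {p : ℤ} {x : V.adjoint.gr} (hx : x ∈ V.adjoint.gr.deg p) (w : M.gr) :
    M.gr.d (M.grAct x w) =
      M.grAct (V.adjoint.gr.d x) w + (-1 : ℂ) ^ p • M.grAct x (M.gr.d w) := by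
  obtain ⟨a, ha, rfl⟩ := exists_selfTotal_eq hx
  obtain ⟨m, rfl⟩ := M.total_surjective w
  rw [grAct_total, ← total_d, ← total_d, selfTotal_d, grAct_total, grAct_total,
    M.action.d_mode _ p a m ha, map_add, map_smul, show p - 2 * -1 - 2 = p by ring]

theorem d_grBracket {p : ℤ} {x : V.adjoint.gr} (hx : x ∈ V.adjoint.gr.deg p) (w : M.gr) :
    M.gr.d (M.grBracket x w) = (-1 : ℂ) ^ (-2 : ℤ) • M.grBracket (V.adjoint.gr.d x) w +
      (-1 : ℂ) ^ (p + -2) • M.grBracket x (M.gr.d w) := by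
  obtain ⟨a, ha, rfl⟩ := exists_selfTotal_eq hx
  obtain ⟨m, rfl⟩ := M.total_surjective w
  rw [grBracket_total, ← total_d, ← total_d, selfTotal_d, grBracket_total, grBracket_total,
    M.action.d_mode _ p a m ha, map_add, map_smul, show p - 2 * 0 - 2 = p + -2 by ring,
    show (-1 : ℂ) ^ (-2 : ℤ) = 1 by norm_num, one_smul]

theorem grBracket_jacobi {p q : ℤ} {x y : V.adjoint.gr} (hx : x ∈ V.adjoint.gr.deg p)
    (hy : y ∈ V.adjoint.gr.deg q) (w : M.gr) :
    M.grBracket x (M.grBracket y w) = M.grBracket (V.adjoint.grBracket x y) w +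
      (-1 : ℂ) ^ ((p + -2) * (q + -2)) • M.grBracket y (M.grBracket x w) := by
  obtain ⟨a, ha, rfl⟩ := exists_selfTotal_eq hx
  obtain ⟨b, hb, rfl⟩ := exists_selfTotal_eq hy
  obtain ⟨m, rfl⟩ := M.total_surjective w
  -- The bracket has even degree, so the shifts in the Koszul sign have no effect.
  rw [show (p + -2) * (q + -2) = p * q + 2 * (2 - p - q) by ring, neg_one_zpow_add_two_mul]
  simp only [grBracket_selfTotal, grBracket_total]
  rw [M.total_jacobi_zero ha hb, sub_add_cancel]

theorem grBracket_grAct {p q : ℤ} {x y : V.adjoint.gr} (hx : x ∈ V.adjoint.gr.deg p)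
    (hy : y ∈ V.adjoint.gr.deg q) (w : M.gr) :
    M.grBracket x (M.grAct y w) = M.grAct (V.adjoint.grBracket x y) w +
      (-1 : ℂ) ^ ((p + -2) * q) • M.grAct y (M.grBracket x w) := by
  obtain ⟨a, ha, rfl⟩ := exists_selfTotal_eq hx
  obtain ⟨b, hb, rfl⟩ := exists_selfTotal_eq hy
  obtain ⟨m, rfl⟩ := M.total_surjective w
  rw [show (p + -2) * q = p * q + 2 * (-q) by ring, neg_one_zpow_add_two_mul]
  simp only [grBracket_selfTotal, grBracket_total, grAct_total]
  rw [M.total_jacobi_zero ha hb, sub_add_cancel]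

theorem grBracket_mul {p q : ℤ} {x y : V.adjoint.gr} (hx : x ∈ V.adjoint.gr.deg p)
    (hy : y ∈ V.adjoint.gr.deg q) (w : M.gr) :
    M.grBracket (V.adjoint.grAct x y) w = M.grAct x (M.grBracket y w) +
      (-1 : ℂ) ^ (p * q) • M.grAct y (M.grBracket x w) := by
  obtain ⟨a, ha, rfl⟩ := exists_selfTotal_eq hx
  obtain ⟨b, hb, rfl⟩ := exists_selfTotal_eq hy
  obtain ⟨m, rfl⟩ := M.total_surjective w
  simp only [grAct_selfTotal, grBracket_total, grAct_total]
  rw [M.total_jacobi_neg_one ha hb _ le_rfl, zero_sub]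

/-! ### Commutativity -/

theorem neg_one_zpow_mul_self (p : ℤ) : (-1 : ℂ) ^ p * (-1 : ℂ) ^ p = 1 := by
  rw [← mul_zpow]
  norm_num

variable (V) in
/-- The operations `zhu e` for the adjoint module, as operations on `V`. -/
def selfZhu (e : ℕ) : V.space →ₗ[ℂ] V.space →ₗ[ℂ] V.space := V.adjoint.zhu e

/-- On the vacuum only the mode -1 contributes, and its coefficient is the constant term 1 of the
binomial series, whatever the exponent. -/
theorem selfZhu_one_right (e : ℕ) (x : V.space) : selfZhu V e x V.one = x := by
  refine V.semisimple.induction (motive := fun x => selfZhu V e x V.one = x) x ?_ (by simp)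
    fun x y hx hy => by rw [map_add, LinearMap.add_apply, hx, hy]
  intro k x hx
  have h : selfZhu V e x V.one =
      selfResidue V 1 (PowerSeries.binomialSeries ℂ ((k : ℂ) / 2 - 1 + e)) x V.one :=
    V.adjoint.zhu_apply e hx V.one
  rw [h, selfResidue_eq_sum _ _ _ _ 1 fun i hi => V.creation x _ (by omega)]
  simp [V.creation']

/-- In `A(V)` the left action and the right action on `V` agree. -/
theorem zhuA_zero_selfCls {p q : ℤ} {x y : V.space} (hx : x ∈ V.space.deg p)
    (hy : y ∈ V.space.deg q) :
    V.adjoint.zhuA 0 zero_le_one (selfCls V x) (selfCls V y) =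
      (-1 : ℂ) ^ (p * q) • V.adjoint.zhuA 1 le_rfl (selfCls V y) (selfCls V x) := by
  -- Left and right actions supercommute modulo O(V); on the vacuum both orders of composition
  -- become single operations.
  have h : selfZhu V 1 y (selfZhu V 0 x V.one) -
      (-1 : ℂ) ^ (q * p) • selfZhu V 0 x (selfZhu V 1 y V.one) ∈ selfO V :=
    V.adjoint.zhu_commutator_mem_O hy hx V.one
  rw [selfZhu_one_right, selfZhu_one_right, mul_comm q p] at h
  have h' : selfCls V (selfZhu V 1 y x - (-1 : ℂ) ^ (p * q) • selfZhu V 0 x y) = 0 :=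
    (Submodule.Quotient.mk_eq_zero V.adjoint.O).2 h
  rw [map_sub, map_smul, sub_eq_zero] at h'
  change selfCls V (selfZhu V 0 x y) = (-1 : ℂ) ^ (p * q) • selfCls V (selfZhu V 1 y x)
  rw [h', smul_smul, neg_one_zpow_mul_self, one_smul]

theorem comm_selfCls {p q : ℤ} {x y : V.space} (hx : x ∈ V.space.deg p)
    (hy : y ∈ V.space.deg q) :
    V.adjoint.comm (selfCls V x) (selfCls V y) =
      V.adjoint.zhuA 1 le_rfl (selfCls V x) (selfCls V y) -
        (-1 : ℂ) ^ (p * q) • V.adjoint.zhuA 1 le_rfl (selfCls V y) (selfCls V x) := by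
  rw [comm, LinearMap.sub_apply, LinearMap.sub_apply, zhuA_zero_selfCls hx hy]

theorem comm_selfCls_skew {p q : ℤ} {x y : V.space} (hx : x ∈ V.space.deg p)
    (hy : y ∈ V.space.deg q) :
    V.adjoint.comm (selfCls V x) (selfCls V y) =
      (-(-1 : ℂ) ^ (p * q)) • V.adjoint.comm (selfCls V y) (selfCls V x) := by
  rw [comm_selfCls hx hy, comm_selfCls hy hx, mul_comm q p, smul_sub, smul_smul, neg_mul,
    neg_one_zpow_mul_self]
  module

theorem IsSymb.smul {p : ℤ} {a : M.A} {x : M.gr} (c : ℂ) (h : M.IsSymb p a x) :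
    M.IsSymb p (c • a) (c • x) := by
  obtain ⟨ha, rfl⟩ := h
  exact ⟨Submodule.smul_mem _ c ha, (map_smul (AssocGraded.symb M.F p) c ⟨a, ha⟩ :)⟩

theorem isSymb_selfTotal {p : ℤ} {x : V.space} (hx : x ∈ V.space.deg p) :
    V.adjoint.IsSymb p (selfCls V x) (selfTotal V x) := V.adjoint.isSymb_total hx

/-- The supercommutator lowers the filtration by two, hence vanishes in the component of degree p +
q. -/
theorem grAct_comm {p q : ℤ} {x y : V.adjoint.gr} (hx : x ∈ V.adjoint.gr.deg p)
    (hy : y ∈ V.adjoint.gr.deg q) :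
    V.adjoint.grAct x y = (-1 : ℂ) ^ (p * q) • V.adjoint.grAct y x := by
  obtain ⟨a, ha, rfl⟩ := exists_selfTotal_eq hx
  obtain ⟨b, hb, rfl⟩ := exists_selfTotal_eq hy
  have h := IsSymb.act V.adjoint (isSymb_selfTotal ha) (isSymb_selfTotal hb)
  have h' := IsSymb.act V.adjoint (isSymb_selfTotal hb) (isSymb_selfTotal ha)
  rw [add_comm q p] at h'
  refine IsSymb.eq _ h (IsSymb.congr _ (IsSymb.smul _ _ h') ?_)
  rw [← comm_selfCls ha hb]
  exact V.adjoint.F_mono (by omega) (V.adjoint.comm_mem_F p q _ _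
    (V.adjoint.cls_mem_F_of_deg ha) (V.adjoint.cls_mem_F_of_deg hb))

/-- The supercommutator on A(V) is skew before passing to symbols, and (p-2)(q-2) has the parity of
pq. -/
theorem grBracket_skew {p q : ℤ} {x y : V.adjoint.gr} (hx : x ∈ V.adjoint.gr.deg p)
    (hy : y ∈ V.adjoint.gr.deg q) :
    V.adjoint.grBracket x y =
      -((-1 : ℂ) ^ ((p + -2) * (q + -2)) • V.adjoint.grBracket y x) := by
  obtain ⟨a, ha, rfl⟩ := exists_selfTotal_eq hx
  obtain ⟨b, hb, rfl⟩ := exists_selfTotal_eq hy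
  have h := IsSymb.bracket V.adjoint (isSymb_selfTotal ha) (isSymb_selfTotal hb)
  have h' := IsSymb.bracket V.adjoint (isSymb_selfTotal hb) (isSymb_selfTotal ha)
  rw [comm_selfCls_skew ha hb] at h
  rw [add_comm q p] at h'
  rw [show (p + -2) * (q + -2) = p * q + 2 * (2 - p - q) by ring, neg_one_zpow_add_two_mul,
    ← neg_smul]
  exact IsSymb.eq _ h (IsSymb.smul _ _ h')

/-! ### The Poisson structures on the associated graded spaces -/

variable (V) in
/-- The dg Poisson algebra `gr A(V)`. -/
def grPoissonAlgebra : DGPoissonAlgebra V.adjoint.gr (-2) where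
  mul := V.adjoint.grAct
  one := selfTotal V V.one
  bracket := V.adjoint.grBracket
  mul_mem _ _ _ _ := V.adjoint.grAct_mem
  one_mem := V.adjoint.total_mem_deg V.one_mem
  mul_assoc := V.adjoint.grAct_grAct
  one_mul := V.adjoint.grAct_one
  mul_one x := by
    obtain ⟨a, rfl⟩ := selfTotal_surjective x
    rw [grAct_selfTotal, V.creation']
  mul_comm _ _ _ _ := grAct_comm
  d_mul _ _ y hx := V.adjoint.d_grAct hx y
  bracket_mem _ _ _ _ := V.adjoint.grBracket_mem
  bracket_skew _ _ _ _ := grBracket_skew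
  bracket_jacobi _ _ _ _ z hx hy := V.adjoint.grBracket_jacobi hx hy z
  bracket_mul _ _ _ _ z hx hy := V.adjoint.grBracket_grAct hx hy z
  d_bracket _ _ y hx := V.adjoint.d_grBracket hx y

/-- The dg Poisson module `gr A(M)`. -/
def grPoissonModule : DGPoissonModuleStr (grPoissonAlgebra V) M.gr where
  act := M.grAct
  bracket := M.grBracket
  act_mem _ _ _ _ := M.grAct_mem
  mul_act := M.grAct_grAct
  one_act := M.grAct_one
  d_act _ _ w hx := M.d_grAct hx w
  bracket_mem _ _ _ _ := M.grBracket_mem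
  bracket_jacobi _ _ _ _ w hx hy := M.grBracket_jacobi hx hy w
  d_bracket _ _ w hx := M.d_grBracket hx w
  bracket_act _ _ _ _ w hx hy := M.grBracket_grAct hx hy w
  mul_bracket _ _ _ _ w hx hy := M.grBracket_mul hx hy w

/-! ### The right action -/

/-- The involution `x ↦ (-1)^|x| x`. -/
def _root_.DGSpace.parity (X : DGSpace.{u}) : X →ₗ[ℂ] X :=
  X.isInternal.glue fun p => (-1 : ℂ) ^ p • (X.deg p).subtype

theorem _root_.DGSpace.parity_apply (X : DGSpace.{u}) {p : ℤ} {x : X} (hx : x ∈ X.deg p) :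
    X.parity x = (-1 : ℂ) ^ p • x :=
  X.isInternal.glue_apply _ hx

theorem parity_Y (n : ℤ) {p : ℤ} {x : V.space} (hx : x ∈ V.space.deg p) (m : M.space) :
    M.space.parity (M.Y n x m) = (-1 : ℂ) ^ p • M.Y n x (M.space.parity m) := by
  refine M.space.isInternal.induction (motive := fun m =>
    M.space.parity (M.Y n x m) = (-1 : ℂ) ^ p • M.Y n x (M.space.parity m)) m ?_ (by simp)
    fun y z hy hz => by simp only [map_add, smul_add, hy, hz]
  intro q m hm
  rw [M.space.parity_apply (M.action.mode_mem n p q x m hx hm), M.space.parity_apply hm, map_smul,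
    smul_smul, ← zpow_add₀ (by norm_num),
    show p + q - 2 * n - 2 = p + q + 2 * (-n - 1) by ring, neg_one_zpow_add_two_mul]

theorem parity_residue (r : ℤ) (F : ℂ⟦X⟧) {p : ℤ} {x : V.space} (hx : x ∈ V.space.deg p)
    (m : M.space) : M.space.parity (M.residue r F x m) =
      (-1 : ℂ) ^ p • M.residue r F x (M.space.parity m) := by
  have h (m : M.space) := eventually_forall_ge_atTop.2
    ((tendsto_natCast_sub r).eventually (M.eventually_Y_eq_zero x m))
  obtain ⟨I, h1, h2⟩ := ((h m).and (h (M.space.parity m))).exists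
  rw [M.residue_eq_sum r F x m I h1, M.residue_eq_sum r F x _ I h2, map_sum, Finset.smul_sum]
  refine Finset.sum_congr rfl fun i _ => ?_
  rw [map_smul, M.parity_Y _ hx, smul_comm]

/-- Modes shift degrees by even integers beyond |x|, so parity sends a residue in x to plus or minus
a residue in x. -/
theorem parity_mem_O {m : M.space} (hm : m ∈ M.O) : M.space.parity m ∈ M.O := by
  refine M.O_induction (motive := fun m => M.space.parity m ∈ M.O) hm ?_ (by simp)
    (fun y z hy hz => by simpa using add_mem hy hz)
    (fun c y hy => by simpa using Submodule.smul_mem _ _ hy)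
  intro p k x hx hxk m
  rw [M.parity_residue _ _ hx]
  exact Submodule.smul_mem _ _ (M.residue_mem_O hxk _ _ _ 0 0 le_rfl (by simp) (by simp))

/-- The involution of `A(M)` induced by the parity. -/
def parityA : M.A →ₗ[ℂ] M.A := M.O.mapQ M.O M.space.parity fun _ hm => M.parity_mem_O hm

theorem parityA_cls {p : ℤ} {m : M.space} (hm : m ∈ M.space.deg p) :
    M.parityA (M.cls m) = (-1 : ℂ) ^ p • M.cls m :=
  (congrArg M.cls (M.space.parity_apply hm)).trans (map_smul _ _ _)

/-- The map `A(M) × A(V) → A(M)` induced by `∗_r`. -/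
def rightA : M.A →ₗ[ℂ] V.adjoint.A →ₗ[ℂ] M.A :=
  -- The sign (-1)^(pq) is 1 for p even and (-1)^q for p odd. The factors (1 ± parity)/2 project
  -- A(V) onto even and odd parts, and the parity of A(M) supplies (-1)^q on the odd part.
  ((1 / 2 : ℂ) • (M.zhuA 0 zero_le_one ∘ₗ (LinearMap.id + V.adjoint.parityA) +
    (M.zhuA 0 zero_le_one).compl₁₂ (LinearMap.id - V.adjoint.parityA) M.parityA)).flip

theorem rightA_cls {p q : ℤ} {x : V.space} {m : M.space} (hx : x ∈ V.space.deg p)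
    (hm : m ∈ M.space.deg q) :
    M.rightA (M.cls m) (selfCls V x) = (-1 : ℂ) ^ (p * q) • M.cls (M.zhu 0 x m) := by
  have h : V.adjoint.parityA (selfCls V x) = (-1 : ℂ) ^ p • selfCls V x :=
    V.adjoint.parityA_cls hx
  rw [rightA, LinearMap.flip_apply, LinearMap.smul_apply, LinearMap.smul_apply,
    LinearMap.add_apply, LinearMap.add_apply, LinearMap.comp_apply, LinearMap.compl₁₂_apply,
    LinearMap.add_apply, LinearMap.sub_apply, LinearMap.id_apply, h, M.parityA_cls hm,
    zpow_mul (-1 : ℂ) p q]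
  simp only [map_add, map_sub, map_smul, LinearMap.add_apply, LinearMap.sub_apply,
    LinearMap.smul_apply, zhuA_cls]
  rcases p.even_or_odd with hp | hp
  · rw [hp.neg_one_zpow, one_zpow]
    module
  · rw [hp.neg_one_zpow]
    module

/-- The sign in front of the right action cancels the sign in the definition of `∗_r`, leaving the
difference of the unsigned operations. -/
theorem comm_eq_sub_rightA {p q : ℤ} {x : V.space} {m : M.space} (hx : x ∈ V.space.deg p)
    (hm : m ∈ M.space.deg q) :
    M.comm (selfCls V x) (M.cls m) = M.zhuA 1 le_rfl (selfCls V x) (M.cls m) -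
      (-1 : ℂ) ^ (p * q) • M.rightA (M.cls m) (selfCls V x) := by
  rw [M.rightA_cls hx hm, smul_smul, neg_one_zpow_mul_self, one_smul]
  rfl

theorem isLeftProduct_zhuA : M.IsLeftProduct (M.zhuA 1 le_rfl) := by
  intro k x m hx
  refine (M.zhuA_cls 1 le_rfl x m).trans (congrArg M.cls ?_)
  rw [M.zhu_apply 1 hx, starL, res_eq_residue, Nat.cast_one, sub_add_cancel]

theorem isRightProduct_rightA : M.IsRightProduct M.rightA := by
  intro k p q x m hx hxk hm
  refine (M.rightA_cls hx hm).trans ?_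
  rw [starR, map_smul, M.zhu_apply 0 hxk, res_eq_residue, Nat.cast_zero, add_zero]

/-! ### Functoriality -/

variable {M} {N : WeakModule.{u, v} V}

/-- Naturality of the symbol map reduces compatibility with action and bracket to f commuting with
the modes -1 and 0. -/
theorem Hom.mapGr_total (f : Hom M N) (m : M.space) :
    (Hom.mapGr f).toLin (M.total m) = N.total (f.toLin m) := by
  refine M.space.isInternal.induction (motive := fun m =>
    (Hom.mapGr f).toLin (M.total m) = N.total (f.toLin m)) m ?_ (by simp)
    fun y z hy hz => by simp only [map_add, hy, hz]
  intro p m hm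
  refine IsSymb.eq N ?_ (N.isSymb_total (f.map_deg p m hm))
  obtain ⟨h, h'⟩ := M.isSymb_total hm
  rw [← h']
  have h2 := f.mapA_mem p _ h
  refine ⟨by rwa [add_zero] at h2, ?_⟩
  refine Eq.trans ?_ (AssocGraded.map_symb M.F N.F 0 f.mapA f.mapA_mem p _ h).symm
  exact AssocGraded.symb_congr N.F (add_zero p).symm rfl _ _

variable (V) in
/-- The functor `M ↦ gr A(M)` to dg Poisson modules. -/
def grPoissonFunctor :
    WeakModule.{u, v} V ⥤ DGPoissonModule.{u, v} (grPoissonAlgebra V) where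
  obj M := ⟨M.gr, M.grPoissonModule⟩
  map {M N} f :=
    { Hom.mapGr f with
      map_act := fun x w => by
        obtain ⟨a, rfl⟩ := selfTotal_surjective x
        obtain ⟨m, rfl⟩ := M.total_surjective w
        change (Hom.mapGr f).toLin (M.grAct _ _) = N.grAct _ ((Hom.mapGr f).toLin _)
        rw [grAct_total, Hom.mapGr_total, Hom.mapGr_total, grAct_total, f.map_mode]
      map_bracket := fun x w => by
        obtain ⟨a, rfl⟩ := selfTotal_surjective x
        obtain ⟨m, rfl⟩ := M.total_surjective w
        change (Hom.mapGr f).toLin (M.grBracket _ _) = N.grBracket _ ((Hom.mapGr f).toLin _)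
        rw [grBracket_total, Hom.mapGr_total, Hom.mapGr_total, grBracket_total, f.map_mode] }
  map_id M := DGPoissonModule.Hom.ext (congrArg DGSpace.Hom.toLin ((grFunctor V).map_id M))
  map_comp f g :=
    DGPoissonModule.Hom.ext (congrArg DGSpace.Hom.toLin ((grFunctor V).map_comp f g))

end DGVOA.WeakModule

end

theorem mainTheorem8 (V : DGVOA.{u}) :
    -- the dg Poisson algebra `gr^[*] A(V)`
    ∃ (star : V.adjoint.A →ₗ[ℂ] V.adjoint.A →ₗ[ℂ] V.adjoint.A)
      (S : DGPoissonAlgebra V.adjoint.gr (-2)),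
      V.adjoint.IsLeftProduct star ∧
      (∀ (p q : ℤ) (a b : V.adjoint.A) (x y : V.adjoint.gr),
        V.adjoint.IsSymb p a x → V.adjoint.IsSymb q b y →
          V.adjoint.IsSymb (p + q) (star a b) (S.mul x y)) ∧
      (∀ (p q : ℤ) (t w : V.space) (x y : V.adjoint.gr),
        t ∈ V.space.deg p → w ∈ V.space.deg q →
        V.adjoint.IsSymb p (V.adjoint.cls t) x → V.adjoint.IsSymb q (V.adjoint.cls w) y →
          V.adjoint.IsSymb (p + q - 2)
            (star (V.adjoint.cls t) (V.adjoint.cls w) -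
              (-1 : ℂ) ^ (p * q) • star (V.adjoint.cls w) (V.adjoint.cls t))
            (S.bracket x y)) ∧
      -- the dg Poisson modules `gr^[*] A(M)`
      ∃ (left : ∀ M : DGVOA.WeakModule.{u, v} V, V.adjoint.A →ₗ[ℂ] M.A →ₗ[ℂ] M.A)
        (right : ∀ M : DGVOA.WeakModule.{u, v} V, M.A →ₗ[ℂ] V.adjoint.A →ₗ[ℂ] M.A)
        (T : ∀ M : DGVOA.WeakModule.{u, v} V, DGPoissonModuleStr S M.gr),
        (∀ M : DGVOA.WeakModule.{u, v} V, M.IsLeftProduct (left M)) ∧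
        (∀ M : DGVOA.WeakModule.{u, v} V, M.IsRightProduct (right M)) ∧
        -- the action is induced by `∗_l`
        (∀ (M : DGVOA.WeakModule.{u, v} V) (p q : ℤ) (a : V.adjoint.A) (b : M.A) (x : V.adjoint.gr)
          (w : M.gr), V.adjoint.IsSymb p a x → M.IsSymb q b w →
            M.IsSymb (p + q) (left M a b) ((T M).act x w)) ∧
        (∀ (M : DGVOA.WeakModule.{u, v} V) (p q : ℤ) (t : V.space) (m : M.space) (x : V.adjoint.gr)
          (w : M.gr), t ∈ V.space.deg p → m ∈ M.space.deg q →
          V.adjoint.IsSymb p (V.adjoint.cls t) x → M.IsSymb q (M.cls m) w →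
            -- the bracket is induced by the commutator
            M.IsSymb (p + q - 2)
              (left M (V.adjoint.cls t) (M.cls m) -
                (-1 : ℂ) ^ (p * q) • right M (M.cls m) (V.adjoint.cls t))
              ((T M).bracket x w) ∧
            -- the formulas for action and bracket in terms of modes
            M.IsSymb (p + q) (M.cls (M.Y (-1) t m)) ((T M).act x w) ∧
            M.IsSymb (p + q - 2) (M.cls (M.Y 0 t m)) ((T M).bracket x w)) ∧
        -- functoriality
        ∃ Φ : DGVOA.WeakModule.{u, v} V ⥤ DGPoissonModule.{u, v} S,
          (∀ M, Φ.obj M = ⟨M.gr, T M⟩) ∧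
          Φ ⋙ DGPoissonModule.forgetToDGSpace S = DGVOA.WeakModule.grFunctor V := by
  refine ⟨V.adjoint.zhuA 1 le_rfl, DGVOA.WeakModule.grPoissonAlgebra V,
    V.adjoint.isLeftProduct_zhuA, fun p q a b x y => DGVOA.WeakModule.IsSymb.act V.adjoint, ?_,
    fun M => M.zhuA 1 le_rfl, fun M => M.rightA, fun M => M.grPoissonModule,
    fun M => M.isLeftProduct_zhuA, fun M => M.isRightProduct_rightA,
    fun M p q a b x w => DGVOA.WeakModule.IsSymb.act M, ?_,
    DGVOA.WeakModule.grPoissonFunctor V, fun M => rfl, rfl⟩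
  · intro p q t w x y ht hw hx hy
    have h := DGVOA.WeakModule.IsSymb.bracket V.adjoint hx hy
    rwa [show V.adjoint.comm (V.adjoint.cls t) (V.adjoint.cls w) = _ from
      DGVOA.WeakModule.comm_selfCls ht hw] at h
  · intro M p q t m x w ht hm hx hw
    have h := DGVOA.WeakModule.IsSymb.bracket M hx hw
    rw [show M.comm (V.adjoint.cls t) (M.cls m) = _ from M.comm_eq_sub_rightA ht hm] at h
    -- A class with a homogeneous preimage is the symbol of that preimage, so the formulas in terms
    -- of modes apply.
    obtain rfl : x = DGVOA.WeakModule.selfTotal V t :=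
      hx.eq V.adjoint (DGVOA.WeakModule.isSymb_selfTotal ht)
    obtain rfl : w = M.total m := hw.eq M (M.isSymb_total hm)
    refine ⟨h, ?_, ?_⟩
    · rw [show M.grPoissonModule.act = M.grAct from rfl, M.grAct_total]
      have := M.isSymb_total (M.action.mode_mem (-1) p q t m ht hm)
      rwa [show p + q - 2 * -1 - 2 = p + q by ring] at this
    · rw [show M.grPoissonModule.bracket = M.grBracket from rfl, M.grBracket_total]
      have := M.isSymb_total (M.action.mode_mem 0 p q t m ht hm)
      rwa [show p + q - 2 * 0 - 2 = p + q - 2 by ring] at this
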